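/- Let $\mathcal H(\mathbb C)$ be the complex Fréchet space of entire functions of one complex variable, with the topology of uniform convergence on compact sets, let $L(\mathcal H(\mathbb C))$ be the space of continuous linear operators on it, and let $D\in L(\mathcal H(\mathbb C))$ be the differentiation operator $Df=f'$. A vector $f\in\mathcal H(\mathbb C)$ is called hypercyclic for $S\in L(\mathcal H(\mathbb C))$ if its orbit $\{S^nf:n=0,1,2,\dots\}$ is dense in $\mathcal H(\mathbb C)$. Let $T\in L(\mathcal H(\mathbb C))$ be such that $TD=DT$ and $T\neq cI$ for every $c\in\mathbb C$. Then the set $$\{f\in\mathcal H(\mathbb C): f\text{ is hypercyclic for } zT \text{ for every } z\in\mathbb C\setminus\{0\}\}$$ is a dense $G_\delta$-subset of $\mathcal H(\mathbb C)$. This contains the Costakis–Mavroudis theorem as a special case: if $p$ is a non-constant polynomial with complex coefficients, then the operator $p(D)$ commutes with $D$ and is not a scalar multiple of the identity, and therefore the set of all $f\in\mathcal H(\mathbb C)$ that are hypercyclic for $a\,p(D)$ for every $a\in\mathbb C\setminus\{0\}$ is a dense $G_\delta$-subset of $\mathcal H(\mathbb C)$. -/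

import Mathlib

open Topology

/-- The elements `x` whose orbit `{F a x : a ∈ A}` under the family `F` is dense in `Y`. -/
def universalElements {A X Y : Type*} [TopologicalSpace Y] (F : A → X → Y) : Set X :=
  {x | Dense (Set.range fun a => F a x)}

/-- The hypercyclic vectors of a continuous linear operator `T`: the universal elements of the
family of powers `T ^ n`, `n = 0, 1, 2, …`. -/
def hypercyclicVectors {X : Type*} [AddCommGroup X] [Module ℂ X] [TopologicalSpace X]
    (T : X →L[ℂ] X) : Set X :=
  universalElements fun n : ℕ => ((T ^ n : X →L[ℂ] X) : X → X)

/-- The common hypercyclic vectors of a family of continuous linear operators. -/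
def commonHypercyclicVectors {A X : Type*} [AddCommGroup X] [Module ℂ X] [TopologicalSpace X]
    (F : A → X →L[ℂ] X) : Set X :=
  ⋂ a, hypercyclicVectors (F a)

/-- The entire functions, as a linear subspace of the space `C(ℂ, ℂ)` of continuous functions. -/
noncomputable def entireSubmodule : Submodule ℂ C(ℂ, ℂ) where
  carrier := {f | Differentiable ℂ f}
  add_mem' hf hg := by
    simpa using! Differentiable.add hf hg
  zero_mem' := differentiable_const 0
  smul_mem' c f hf := by
    simpa using! Differentiable.const_smul hf c

/-- The complex Fréchet space of entire functions of one variable. Its topology is the one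
induced from the compact-open topology of `C(ℂ, ℂ)`, that is, uniform convergence on compact
sets. -/
def EntireSpace : Type := entireSubmodule

namespace EntireSpace

noncomputable instance : AddCommGroup EntireSpace := inferInstanceAs (AddCommGroup entireSubmodule)

noncomputable instance : Module ℂ EntireSpace := inferInstanceAs (Module ℂ entireSubmodule)

instance : TopologicalSpace EntireSpace := inferInstanceAs (TopologicalSpace entireSubmodule)

instance : IsTopologicalAddGroup EntireSpace :=
  Submodule.topologicalAddGroup entireSubmodule

instance : ContinuousSMul ℂ EntireSpace :=
  inferInstanceAs (ContinuousSMul ℂ entireSubmodule)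

instance : T2Space EntireSpace := inferInstanceAs (T2Space entireSubmodule)

/-- An entire function as a continuous function. -/
def toContinuousMap (f : EntireSpace) : C(ℂ, ℂ) := f.1

noncomputable instance : CoeFun EntireSpace fun _ => ℂ → ℂ := ⟨fun f => f.toContinuousMap⟩

@[ext]
theorem ext {f g : EntireSpace} (h : ∀ z, f z = g z) : f = g :=
  Subtype.ext (ContinuousMap.ext h)

theorem differentiable (f : EntireSpace) : Differentiable ℂ f :=
  f.2

theorem differentiable_deriv (f : EntireSpace) : Differentiable ℂ (deriv f) :=
  fun z => ((f.differentiable.analyticAt z).deriv).differentiableAt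

theorem continuous_toContinuousMap : Continuous toContinuousMap :=
  continuous_subtype_val

end EntireSpace

/-- The derivative of an entire function, as an entire function. -/
noncomputable def entireDeriv (f : EntireSpace) : EntireSpace :=
  ⟨⟨deriv f, f.differentiable_deriv.continuous⟩, f.differentiable_deriv⟩

theorem continuous_entireDeriv : Continuous entireDeriv := by
  refine Continuous.subtype_mk (f := fun f : EntireSpace =>
    (⟨deriv f, f.differentiable_deriv.continuous⟩ : C(ℂ, ℂ))) ?_ _
  rw [continuous_iff_continuousAt]
  intro f
  rw [ContinuousAt, ContinuousMap.tendsto_iff_tendstoLocallyUniformly,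
    ← tendstoLocallyUniformlyOn_univ]
  have h : TendstoLocallyUniformlyOn (fun g : EntireSpace => (g : ℂ → ℂ)) f (𝓝 f) Set.univ := by
    rw [tendstoLocallyUniformlyOn_univ, ← ContinuousMap.tendsto_iff_tendstoLocallyUniformly]
    exact EntireSpace.continuous_toContinuousMap.continuousAt
  exact h.deriv (Filter.Eventually.of_forall fun g => g.differentiable.differentiableOn) isOpen_univ

/-- The differentiation operator `f ↦ f'` on the space of entire functions. -/
noncomputable def differentiationOp : EntireSpace →L[ℂ] EntireSpace where
  toFun := entireDeriv
  map_add' f g := by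
    ext z
    exact deriv_add (f.differentiable z) (g.differentiable z)
  map_smul' c f := by
    ext z
    exact deriv_const_smul c (f.differentiable z)
  cont := continuous_entireDeriv

/-! Since `T` commutes with `D`, it maps each exponential `e^{lz}` to an eigenvector of `D`, so `T
e^{lz} = φ(l) e^{lz}` with `φ` (`symbol`) entire. Exponentials whose frequencies accumulate span a
dense subspace, so `φ` is non-constant. By Baire's theorem and compactness, it suffices that for
each nonempty open `U` and each `s₀`, the `f` whose orbits under all `zT` with `log |z|` near `s₀`
meet `U` are dense (`exists_dense_forall_exists_mem`).

Take `x` with `r^n T^n x → 0` for a suitable `r`, and `y ∈ U`. Put `f = x + ∑_{k ∈ K} b_k Y_k(-Nk)`,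
where `Y_k` is a bilateral `T`-orbit passing near `y` at time `0`, of size `O(e^{n m_k} / (1 +
n²))`. At time `Nj` the `j`-th summand is close to `y` if `z^{Nj} b_j ≈ 1`. With `|b_k| =
e^{-Nkρ_k}` and `log |z| ≈ ρ_j`, the other summands are `O(e^{N(jρ_j - kρ_k + (j-k)m_k)} /
(N(j-k))²)`.

Three constructions make this work. `exists_radii` takes `ρ_k` equal to a constant minus `κ log k`:
then `kρ_k` is concave with slope `-m_k`, so the exponent is nonpositive, while `ρ` varies slowly
enough that each `log |z|` in an interval is matched on a whole block of `L` indices.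
`exists_phases` supplies `L` phases, one of which corrects the argument of any given `z`.
`hasDecayingOrbits_expFun` obtains the orbits by averaging `e^{nω} e^{ψ(ω)z}` over a short vertical
segment `Re ω = m`, where `φ(ψ(ω)) = e^ω`; a weight with double zeros at the ends produces the
quadratic decay. -/

namespace EntireSpace

open Filter TopologicalSpace

/-! ### The space of entire functions and the density of exponentials. -/

@[simp] theorem add_apply (f g : EntireSpace) (z : ℂ) : (f + g) z = f z + g z := rfl

@[simp] theorem sub_apply (f g : EntireSpace) (z : ℂ) : (f - g) z = f z - g z := rfl

@[simp] theorem smul_apply (c : ℂ) (f : EntireSpace) (z : ℂ) : (c • f) z = c * f z := rfl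

@[simp] theorem zero_apply (z : ℂ) : (0 : EntireSpace) z = 0 := rfl

/-- Evaluation at a point, as a linear map. -/
noncomputable def evalₗ (z : ℂ) : EntireSpace →ₗ[ℂ] ℂ where
  toFun f := f z
  map_add' _ _ := rfl
  map_smul' _ _ := rfl

@[simp] theorem sum_apply {ι : Type*} (s : Finset ι) (f : ι → EntireSpace) (z : ℂ) :
    (∑ i ∈ s, f i) z = ∑ i ∈ s, f i z :=
  map_sum (evalₗ z) f s

theorem isClosed_range_toContinuousMap : IsClosed (entireSubmodule : Set C(ℂ, ℂ)) := by
  rw [← isSeqClosed_iff_isClosed]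
  intro u f hu hf
  rw [ContinuousMap.tendsto_iff_tendstoLocallyUniformly, ← tendstoLocallyUniformlyOn_univ] at hf
  have := hf.differentiableOn (Eventually.of_forall fun n => (hu n).differentiableOn) isOpen_univ
  exact differentiableOn_univ.1 this

instance : BaireSpace EntireSpace := by
  have : IsCompletelyPseudoMetrizableSpace C(ℂ, ℂ) :=
    let _ := UniformSpace.pseudoMetricSpace C(ℂ, ℂ)
    inferInstance
  have : IsCompletelyPseudoMetrizableSpace entireSubmodule :=
    isClosed_range_toContinuousMap.isCompletelyPseudoMetrizableSpace
  exact inferInstanceAs (BaireSpace entireSubmodule)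

instance : SecondCountableTopology EntireSpace :=
  (IsEmbedding.subtypeVal (p := (· ∈ entireSubmodule))).secondCountableTopology

theorem exists_radius_of_mem_nhds {f : EntireSpace} {U : Set EntireSpace} (hU : U ∈ 𝓝 f) :
    ∃ R > 0, ∃ ε > 0, ∀ g : EntireSpace, (∀ z, ‖z‖ ≤ R → ‖g z - f z‖ ≤ ε) → g ∈ U := by
  obtain ⟨V, hV, hVU⟩ := mem_nhds_induced (toContinuousMap) f U |>.1 hU
  have hb := Metric.uniformity_basis_dist (α := ℂ).compactConvergenceUniformity (α := ℂ)
  obtain ⟨⟨K, ε⟩, ⟨hK, hε⟩, h⟩ := (nhds_basis_uniformity' hb).mem_iff.1 hV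
  obtain ⟨R, hR⟩ := hK.isBounded.exists_norm_le
  refine ⟨max R 1, by positivity, ε / 2, half_pos hε, fun g hg => hVU (h ?_)⟩
  intro z hz
  have := hg z ((hR z hz).trans (le_max_left _ _))
  simp only [Set.mem_ofPred_eq]
  rw [dist_comm, dist_eq_norm]
  exact this.trans_lt (half_lt_self hε)

theorem tendsto_of_forall_radius {ι : Type*} {l : Filter ι} {F : ι → EntireSpace} {f : EntireSpace}
    (h : ∀ R > 0, ∀ ε > 0, ∀ᶠ i in l, ∀ z, ‖z‖ ≤ R → ‖F i z - f z‖ ≤ ε) :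
    Tendsto F l (𝓝 f) := by
  refine tendsto_def.2 fun U hU => ?_
  obtain ⟨R, hR, ε, hε, hg⟩ := exists_radius_of_mem_nhds hU
  filter_upwards [h R hR ε hε] with i hi using hg _ hi

theorem continuous_eval (z : ℂ) : Continuous fun f : EntireSpace => f z :=
  (continuous_eval_const z).comp continuous_toContinuousMap

/-- The product of two entire functions. -/
noncomputable def mul (f g : EntireSpace) : EntireSpace :=
  ⟨⟨fun z => f z * g z, (f.differentiable.mul g.differentiable).continuous⟩,
    f.differentiable.mul g.differentiable⟩

@[simp] theorem mul_apply (f g : EntireSpace) (z : ℂ) : mul f g z = f z * g z := rfl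

/-- The exponential function `z ↦ exp (l z)`. -/
noncomputable def expFun (l : ℂ) : EntireSpace :=
  ⟨⟨fun z => Complex.exp (l * z), by fun_prop⟩, by
    change Differentiable ℂ fun z => Complex.exp (l * z)
    fun_prop⟩

@[simp] theorem expFun_apply (l z : ℂ) : expFun l z = Complex.exp (l * z) := rfl

/-- The monomial `z ↦ z ^ n`. -/
noncomputable def powFun (n : ℕ) : EntireSpace :=
  ⟨⟨fun z => z ^ n, by fun_prop⟩, by
    change Differentiable ℂ fun z => z ^ n
    fun_prop⟩

@[simp] theorem powFun_apply (n : ℕ) (z : ℂ) : powFun n z = z ^ n := rfl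

theorem exists_norm_le (f : EntireSpace) (R : ℝ) : ∃ C > 0, ∀ z, ‖z‖ ≤ R → ‖f z‖ ≤ C := by
  obtain ⟨C, hC⟩ := (isCompact_closedBall (0 : ℂ) R).exists_bound_of_continuousOn
    f.differentiable.continuous.continuousOn
  exact ⟨max C 1, by positivity, fun z hz => (hC z (by simpa using hz)).trans (le_max_left _ _)⟩

/-- The difference quotients of order `n` of `l ↦ exp (l z)` converge. -/
theorem tendsto_expFun_quotient (a : ℂ) (n : ℕ) :
    Tendsto (fun l : ℂ => ((l - a) ^ n)⁻¹ • (expFun l -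
      ∑ k ∈ Finset.range n, ((l - a) ^ k * (k.factorial : ℂ)⁻¹) • mul (powFun k) (expFun a)))
      (𝓝[≠] a) (𝓝 ((n.factorial : ℂ)⁻¹ • mul (powFun n) (expFun a))) := by
  refine tendsto_of_forall_radius fun R hR ε hε => ?_
  set C := Real.exp (‖a‖ * R) * (R ^ (n + 1) * Real.exp R) with hC
  have hCpos : 0 < C := by positivity
  have hlim : ∀ᶠ l in 𝓝[≠] a, ‖l - a‖ < min 1 (ε / C) := by
    have : Tendsto (fun l : ℂ => ‖l - a‖) (𝓝 a) (𝓝 0) := by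
      have : Continuous fun l : ℂ => ‖l - a‖ := by fun_prop
      simpa using this.tendsto a
    exact nhdsWithin_le_nhds (this.eventually_lt_const (by positivity))
  filter_upwards [hlim, self_mem_nhdsWithin] with l hl hla z hz
  have hla' : l - a ≠ 0 := sub_ne_zero.2 hla
  have hl1 : ‖l - a‖ ≤ 1 := (hl.trans_le (min_le_left _ _)).le
  have hl2 : ‖l - a‖ ≤ ε / C := (hl.trans_le (min_le_right _ _)).le
  have key := Complex.norm_exp_sub_sum_le_norm_mul_exp ((l - a) * z) (n + 1)
  -- After `e^{az}` is factored out, the error is the Taylor remainder of order `n + 1` of `exp ((l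
  -- - a) z)` divided by `(l - a)^n`, so one factor `|l - a|` survives.
  have hid : (((l - a) ^ n)⁻¹ • (expFun l -
      ∑ k ∈ Finset.range n, ((l - a) ^ k * (k.factorial : ℂ)⁻¹) • mul (powFun k) (expFun a))) z
      - ((n.factorial : ℂ)⁻¹ • mul (powFun n) (expFun a)) z
      = ((l - a) ^ n)⁻¹ * Complex.exp (a * z) * (Complex.exp ((l - a) * z) -
        ∑ m ∈ Finset.range (n + 1), ((l - a) * z) ^ m / (m.factorial : ℂ)) := by
    have he : Complex.exp (l * z) = Complex.exp (a * z) * Complex.exp ((l - a) * z) := by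
      rw [← Complex.exp_add]; ring_nf
    simp only [smul_apply, sub_apply, sum_apply, mul_apply, powFun_apply, expFun_apply]
    have hs : ∑ k ∈ Finset.range n, (l - a) ^ k * (k.factorial : ℂ)⁻¹ * (z ^ k * Complex.exp (a * z))
        = Complex.exp (a * z) *
          ∑ m ∈ Finset.range n, ((l - a) * z) ^ m / (m.factorial : ℂ) := by
      rw [Finset.mul_sum]
      refine Finset.sum_congr rfl fun k _ => ?_
      rw [mul_pow]; ring
    rw [hs, Finset.sum_range_succ, he, mul_pow]
    have hne : (l - a) ^ n ≠ 0 := pow_ne_zero _ hla'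
    have hf : (n.factorial : ℂ) ≠ 0 := by exact_mod_cast n.factorial_ne_zero
    field_simp
    ring
  rw [hid, norm_mul, norm_mul, norm_inv, norm_pow]
  have hpos : 0 < ‖l - a‖ := norm_pos_iff.2 hla'
  have h1 : ‖Complex.exp (a * z)‖ ≤ Real.exp (‖a‖ * R) := by
    rw [Complex.norm_exp]
    refine Real.exp_le_exp.2 ((Complex.re_le_norm _).trans ?_)
    rw [norm_mul]; gcongr
  have h2 : ‖(l - a) * z‖ ≤ R := by
    rw [norm_mul]
    calc _ ≤ 1 * R := by gcongr
      _ = R := one_mul _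
  calc _ ≤ (‖l - a‖ ^ n)⁻¹ * Real.exp (‖a‖ * R) *
        ((‖l - a‖ * R) ^ (n + 1) * Real.exp R) := by
        refine mul_le_mul (by gcongr) (key.trans ?_) (norm_nonneg _) (by positivity)
        rw [norm_mul] at h2 ⊢
        gcongr
    _ = ‖l - a‖ * C := by
        rw [hC, mul_pow, pow_succ ‖l - a‖]; field_simp
    _ ≤ ε / C * C := by gcongr
    _ = ε := by field_simp

theorem tendsto_mul_left {ι : Type*} {l : Filter ι} {F : ι → EntireSpace} {f : EntireSpace}
    (g : EntireSpace) (h : ∀ R > 0, ∀ ε > 0, ∀ᶠ i in l, ∀ z, ‖z‖ ≤ R → ‖F i z - f z‖ ≤ ε) :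
    Tendsto (fun i => mul (F i) g) l (𝓝 (mul f g)) := by
  refine tendsto_of_forall_radius fun R hR ε hε => ?_
  obtain ⟨C, hC, hg⟩ := g.exists_norm_le R
  filter_upwards [h R hR (ε / C) (by positivity)] with i hi z hz
  rw [mul_apply, mul_apply, ← sub_mul, norm_mul]
  calc _ ≤ ε / C * C := by
        gcongr
        exacts [hi z hz, hg z hz]
    _ = ε := by field_simp

/-- The exponentials with frequencies in a set with an accumulation point span a dense subspace. -/
theorem dense_span_expFun {S : Set ℂ} {a : ℂ} (ha : AccPt a (𝓟 S)) :
    Dense (Submodule.span ℂ (expFun '' S) : Set EntireSpace) := by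
  set W := (Submodule.span ℂ (expFun '' S)).topologicalClosure with hW
  have hWc : IsClosed (W : Set EntireSpace) := Submodule.isClosed_topologicalClosure _
  have hS : ∀ l ∈ S, expFun l ∈ W := fun l hl =>
    Submodule.le_topologicalClosure _ (Submodule.subset_span ⟨l, hl, rfl⟩)
  have hfreq : ∃ᶠ l in 𝓝[≠] a, l ∈ S := accPt_iff_frequently_nhdsNE.1 ha
  have hpow : ∀ n, mul (powFun n) (expFun a) ∈ W := by
    intro n
    induction n using Nat.strong_induction_on with
    | _ n ih =>
      have hmem : (n.factorial : ℂ)⁻¹ • mul (powFun n) (expFun a) ∈ W := by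
        refine hWc.mem_of_frequently_of_tendsto (hfreq.mono fun l hl => ?_)
          (tendsto_expFun_quotient a n)
        exact W.smul_mem _ (W.sub_mem (hS l hl) (W.sum_mem fun k hk =>
          W.smul_mem _ (ih k (Finset.mem_range.1 hk))))
      have hf : (n.factorial : ℂ) ≠ 0 := by exact_mod_cast n.factorial_ne_zero
      simpa [smul_smul, hf] using W.smul_mem (n.factorial : ℂ) hmem
  have htop : ∀ f : EntireSpace, f ∈ W := by
    intro f
    -- The closed span contains every `z^n e^{az}`, so `f` is approximated by `e^{az}` times the
    -- Taylor polynomials of `f e^{-az}`.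
    set g := mul f (expFun (-a)) with hg
    have hp : HasFPowerSeriesOnBall (g : ℂ → ℂ) (cauchyPowerSeries g 0 (1 : NNReal)) 0 ⊤ :=
      g.differentiable.hasFPowerSeriesOnBall 0 zero_lt_one
    set p := cauchyPowerSeries (g : ℂ → ℂ) 0 (1 : NNReal)
    let P : ℕ → EntireSpace := fun n => ∑ k ∈ Finset.range n, p.coeff k • powFun k
    have hfg : f = mul g (expFun a) := by
      ext z
      simp only [hg, mul_apply, expFun_apply, mul_assoc]
      rw [← Complex.exp_add]
      simp
    rw [hfg]
    have hlim : Tendsto (fun n => mul (P n) (expFun a)) atTop (𝓝 (mul g (expFun a))) := by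
      refine tendsto_mul_left _ fun R hR ε hε => ?_
      have h := hp.tendstoUniformlyOn (r' := (R + 1).toNNReal) (by simp)
      filter_upwards [Metric.tendstoUniformlyOn_iff.1 h ε hε] with n hn z hz
      have hz' := hn z (by
        rw [Real.coe_toNNReal _ (by positivity), mem_ball_zero_iff]; linarith)
      rw [dist_comm, dist_eq_norm] at hz'
      refine le_of_eq_of_le ?_ hz'.le
      congr 2
      · simp only [P, sum_apply, smul_apply, powFun_apply, FormalMultilinearSeries.partialSum]
        refine Finset.sum_congr rfl fun k _ => ?_
        rw [FormalMultilinearSeries.apply_eq_pow_smul_coeff, smul_eq_mul, mul_comm]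
      · simp
    refine hWc.mem_of_tendsto hlim (Eventually.of_forall fun n => ?_)
    have : mul (P n) (expFun a) = ∑ k ∈ Finset.range n, p.coeff k • mul (powFun k) (expFun a) := by
      ext z
      simp [P, Finset.sum_mul, mul_assoc]
    rw [this]
    exact W.sum_mem fun k _ => W.smul_mem _ (hpow k)
  intro f
  exact htop f

end EntireSpace

/-! ### Exponentials as eigenvectors; the symbol of an operator. -/

namespace EntireSpace

open Filter TopologicalSpace

theorem differentiationOp_apply (f : EntireSpace) (z : ℂ) : differentiationOp f z = deriv f z := rfl

theorem differentiationOp_expFun (l : ℂ) : differentiationOp (expFun l) = l • expFun l := by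
  ext z
  have h : HasDerivAt (fun z => Complex.exp (l * z)) (Complex.exp (l * z) * (l * 1)) z :=
    ((hasDerivAt_id z).const_mul l).cexp
  rw [differentiationOp_apply, smul_apply]
  refine h.deriv.trans ?_
  simp [mul_comm]

/-- The eigenvectors of differentiation are the multiples of exponentials. -/
theorem eq_smul_expFun_of_differentiationOp {g : EntireSpace} {l : ℂ}
    (h : differentiationOp g = l • g) : g = g 0 • expFun l := by
  have hd : ∀ z, HasDerivAt (fun w => g w * Complex.exp (-l * w)) 0 z := by
    intro z
    have h1 : HasDerivAt (g : ℂ → ℂ) (l * g z) z := by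
      have := (g.differentiable z).hasDerivAt
      rwa [← differentiationOp_apply, h] at this
    have h2 : HasDerivAt (fun z => Complex.exp (-l * z)) (Complex.exp (-l * z) * (-l * 1)) z :=
      ((hasDerivAt_id z).const_mul (-l)).cexp
    refine (h1.mul h2).congr_deriv ?_
    ring
  ext z
  have hc := is_const_of_deriv_eq_zero (fun z => (hd z).differentiableAt) (fun z => (hd z).deriv) z 0
  simp only [mul_zero, Complex.exp_zero, mul_one] at hc
  rw [smul_apply, expFun_apply, ← hc, mul_assoc, ← Complex.exp_add]
  simp

/-- The value at `0` of the image of the exponential of frequency `l`; it is the corresponding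
eigenvalue when `T` commutes with differentiation. -/
noncomputable def symbol (T : EntireSpace →L[ℂ] EntireSpace) (l : ℂ) : ℂ := T (expFun l) 0

/-- `T` preserves the eigenspaces of differentiation, and these are one-dimensional. -/
theorem apply_expFun {T : EntireSpace →L[ℂ] EntireSpace}
    (hT : T ∘L differentiationOp = differentiationOp ∘L T) (l : ℂ) :
    T (expFun l) = symbol T l • expFun l := by
  refine eq_smul_expFun_of_differentiationOp ?_
  have := DFunLike.congr_fun hT (expFun l)
  simp only [ContinuousLinearMap.comp_apply, differentiationOp_expFun, map_smul] at this
  exact this.symm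

theorem pow_apply_expFun {T : EntireSpace →L[ℂ] EntireSpace}
    (hT : T ∘L differentiationOp = differentiationOp ∘L T) (l : ℂ) (n : ℕ) :
    (T ^ n) (expFun l) = symbol T l ^ n • expFun l := by
  induction n with
  | zero => simp
  | succ n ih =>
    rw [pow_succ', mul_apply_eq_comp, ih, map_smul, apply_expFun hT, smul_smul, pow_succ]

theorem differentiable_symbol (T : EntireSpace →L[ℂ] EntireSpace) :
    Differentiable ℂ (symbol T) := by
  intro a
  -- For `n = 1` these are the difference quotients of `l ↦ expFun l`; applying `T` and evaluating
  -- at `0` gives those of the symbol.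
  have h := tendsto_expFun_quotient a 1
  have h2 := ((continuous_eval 0).comp T.continuous).continuousAt.tendsto.comp h
  refine HasDerivAt.differentiableAt (hasDerivAt_iff_tendsto_slope.2 (h2.congr fun l => ?_))
  have hm : mul (powFun 0) (expFun a) = expFun a := by ext z; simp
  simp [slope_def_field, symbol, hm, div_eq_inv_mul]

theorem symbol_not_const {T : EntireSpace →L[ℂ] EntireSpace}
    (hT : T ∘L differentiationOp = differentiationOp ∘L T)
    (hc : ∀ c : ℂ, T ≠ c • ContinuousLinearMap.id ℂ EntireSpace) (c : ℂ) :
    ∃ l, symbol T l ≠ c := by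
  by_contra! h
  refine hc c ?_
  have hd : Dense (Submodule.span ℂ (expFun '' Set.univ) : Set EntireSpace) :=
    dense_span_expFun (a := 0) (by rw [accPt_iff_frequently_nhdsNE]; simp [frequently_true_iff_neBot]
                                   infer_instance)
  refine ContinuousLinearMap.ext_on hd ?_
  rintro _ ⟨l, -, rfl⟩
  simp [apply_expFun hT, h l]

end EntireSpace

/-! ### Level sets of the modulus of an entire function. -/

section Symbol

open Filter Metric

/-- A non-constant entire function attains values of arbitrarily small modulus. -/
theorem exists_norm_lt_of_entire {φ : ℂ → ℂ} (hφ : Differentiable ℂ φ)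
    (hc : ∀ c, ∃ l, φ l ≠ c) {τ : ℝ} (hτ : 0 < τ) : ∃ l, ‖φ l‖ < τ := by
  by_contra! h
  have hne : ∀ l, φ l ≠ 0 := fun l => norm_pos_iff.1 (hτ.trans_le (h l))
  obtain ⟨c, hcc⟩ := (hφ.inv hne).exists_eq_const_of_bounded
    (isBounded_iff_forall_norm_le.2 ⟨τ⁻¹, by
      rintro _ ⟨l, rfl⟩
      rw [Pi.inv_apply, norm_inv]
      exact inv_anti₀ hτ (h l)⟩)
  obtain ⟨l, hl⟩ := hc c⁻¹
  exact hl (by rw [← inv_inv (φ l)]; exact congrArg _ (congrFun hcc l))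

/-- A non-constant entire function attains values of arbitrarily large modulus. -/
theorem exists_lt_norm_of_entire {φ : ℂ → ℂ} (hφ : Differentiable ℂ φ)
    (hc : ∀ c, ∃ l, φ l ≠ c) (τ : ℝ) : ∃ l, τ < ‖φ l‖ := by
  by_contra! h
  obtain ⟨c, hcc⟩ := hφ.exists_eq_const_of_bounded
    (isBounded_iff_forall_norm_le.2 ⟨τ, by rintro _ ⟨l, rfl⟩; exact h l⟩)
  obtain ⟨l, hl⟩ := hc c
  exact hl (congrFun hcc l)

theorem exists_norm_eq_of_entire {φ : ℂ → ℂ} (hφ : Differentiable ℂ φ)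
    (hc : ∀ c, ∃ l, φ l ≠ c) {τ : ℝ} (hτ : 0 < τ) : ∃ l, ‖φ l‖ = τ := by
  obtain ⟨a, ha⟩ := exists_norm_lt_of_entire hφ hc hτ
  obtain ⟨b, hb⟩ := exists_lt_norm_of_entire hφ hc τ
  exact mem_range_of_exists_le_of_exists_ge (hφ.continuous.norm) ⟨a, ha.le⟩ ⟨b, hb.le⟩

/-- A logarithmic local inverse at a point where the derivative does not vanish. -/
theorem exists_log_localInverse {φ : ℂ → ℂ} (hφ : Differentiable ℂ φ) {l ζ : ℂ}
    (hd : deriv φ l ≠ 0) (hl : φ l = Complex.exp ζ) :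
    ∃ η > 0, ∃ ψ : ℂ → ℂ, DifferentiableOn ℂ ψ (ball ζ η) ∧ ψ ζ = l ∧
      ∀ w ∈ ball ζ η, φ (ψ w) = Complex.exp w := by
  have hs : HasStrictDerivAt φ (deriv φ l) l := (hφ.analyticAt l).hasStrictDerivAt
  set g := hs.localInverse φ (deriv φ l) l hd with hg
  have hgl : g (φ l) = l := (hs.hasStrictFDerivAt_equiv hd).localInverse_apply_image
  have hgd : ∀ᶠ w in 𝓝 (φ l), DifferentiableAt ℂ g w := by
    have : AnalyticAt ℂ g (φ l) := (hφ.analyticAt l).analyticAt_localInverse hd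
    filter_upwards [this.eventually_analyticAt] with w hw using hw.differentiableAt
  have hgi : ∀ᶠ w in 𝓝 (φ l), φ (g w) = w :=
    (hs.hasStrictFDerivAt_equiv hd).eventually_right_inverse
  have hexp : Tendsto Complex.exp (𝓝 ζ) (𝓝 (φ l)) := hl ▸ Complex.continuous_exp.tendsto ζ
  obtain ⟨η, hη, hball⟩ := Metric.eventually_nhds_iff_ball.1
    (hexp.eventually (hgd.and hgi))
  refine ⟨η, hη, fun w => g (Complex.exp w), fun w hw => ?_, by simp only [← hl, hgl], fun w hw =>
    (hball w hw).2⟩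
  exact ((hball w hw).1.comp w Complex.differentiableAt_exp).differentiableWithinAt

/-- On a level set of the modulus of a non-constant entire function, the points where the derivative
does not vanish accumulate. -/
theorem exists_accPt_norm_eq {φ : ℂ → ℂ} (hφ : Differentiable ℂ φ)
    (hc : ∀ c, ∃ l, φ l ≠ c) {τ : ℝ} (hτ : 0 < τ) :
    ∃ a, AccPt a (𝓟 {l | ‖φ l‖ = τ ∧ deriv φ l ≠ 0}) := by
  obtain ⟨a, ha⟩ := exists_norm_eq_of_entire hφ hc hτ
  refine ⟨a, ?_⟩
  rw [accPt_iff_frequently_nhdsNE]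
  have hda : AnalyticOnNhd ℂ (deriv φ) Set.univ := fun z _ => (hφ.analyticAt z).deriv
  have hcrit : ∀ᶠ l in 𝓝[≠] a, deriv φ l ≠ 0 := by
    rcases (hda a trivial).eventually_eq_zero_or_eventually_ne_zero with h | h
    · exfalso
      have h0 := hda.eq_of_eventuallyEq (g := 0) (fun z _ => analyticAt_const) h
      obtain ⟨l, hl⟩ := hc (φ a)
      exact hl (is_const_of_deriv_eq_zero hφ (fun z => congrFun h0 z) l a)
    · exact h
  -- Open mapping: points of the circle `|w| = τ` near `φ a` have preimages near `a`, so the level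
  -- set accumulates at `a`; critical points are isolated and can be discarded.
  have hopen : 𝓝 (φ a) ≤ map φ (𝓝 a) := by
    rcases (hφ.analyticAt a).eventually_constant_or_nhds_le_map_nhds with h | h
    · exfalso
      have hφa : AnalyticOnNhd ℂ φ Set.univ := fun z _ => hφ.analyticAt z
      have h0 := hφa.eq_of_eventuallyEq
        (g := fun _ => φ a) (fun z _ => analyticAt_const) h
      obtain ⟨l, hl⟩ := hc (φ a)
      exact hl (congrFun h0 l)
    · exact h
  have hcirc : ∃ᶠ w in 𝓝[≠] (φ a), ‖w‖ = τ := by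
    have hne : φ a ≠ 0 := norm_pos_iff.1 (ha ▸ hτ)
    have hlim : Tendsto (fun t : ℝ => φ a * Complex.exp (t * Complex.I)) (𝓝[≠] 0)
        (𝓝[≠] (φ a)) := by
      refine tendsto_nhdsWithin_iff.2 ⟨?_, ?_⟩
      · have : Continuous (fun t : ℝ => φ a * Complex.exp (t * Complex.I)) := by fun_prop
        have := this.tendsto 0
        simp only [Complex.ofReal_zero, zero_mul, Complex.exp_zero, mul_one] at this
        exact this.mono_left nhdsWithin_le_nhds
      · have h1 : ∀ᶠ t : ℝ in 𝓝[≠] 0, |t| < 1 :=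
          nhdsWithin_le_nhds (by
            have : Continuous fun t : ℝ => |t| := by fun_prop
            exact (this.tendsto 0).eventually_lt_const (by simp))
        filter_upwards [h1, self_mem_nhdsWithin] with t ht ht0 h
        have h' : Complex.exp (t * Complex.I) = 1 := by
          have := Set.mem_singleton_iff.1 h
          exact mul_left_cancel₀ hne (by rw [this, mul_one])
        obtain ⟨n, hn⟩ := Complex.exp_eq_one_iff.1 h'
        have hn' : t = n * (2 * Real.pi) := by
          have := congrArg Complex.im hn
          simpa using this
        have hn0 : n ≠ 0 := by
          rintro rfl
          exact ht0 (by simpa using hn')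
        have : (1 : ℝ) ≤ |(n : ℝ)| := by exact_mod_cast Int.one_le_abs hn0
        rw [hn', abs_mul, abs_of_pos Real.two_pi_pos] at ht
        nlinarith [Real.pi_gt_three]
    refine hlim.frequently (Eventually.frequently (Eventually.of_forall fun t => ?_))
    rw [norm_mul, Complex.norm_exp_ofReal_mul_I, mul_one, ha]
  intro hev
  have hev' : ∀ᶠ l in 𝓝 a, l ≠ a → ¬ ‖φ l‖ = τ := by
    have := hev.and hcrit
    rw [eventually_nhdsWithin_iff] at this
    filter_upwards [this] with l hl hla h
    exact (hl hla).1 ⟨h, (hl hla).2⟩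
  refine hcirc ?_
  rw [eventually_nhdsWithin_iff]
  have hmem : φ '' {l | l ≠ a → ¬ ‖φ l‖ = τ} ∈ 𝓝 (φ a) := hopen (image_mem_map hev')
  filter_upwards [hmem] with w hw hwa
  obtain ⟨l, hl, rfl⟩ := hw
  exact hl (fun h => hwa (by simp [h]))

end Symbol

/-! ### Choice of phases and radii. -/

section Numbers

theorem norm_pow_sub_one_le {w : ℂ} (hw : ‖w‖ = 1) (k : ℕ) : ‖w ^ k - 1‖ ≤ k * ‖w - 1‖ := by
  induction k with
  | zero => simp
  | succ k ih =>
    have : w ^ (k + 1) - 1 = w * (w ^ k - 1) + (w - 1) := by ring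
    rw [this]
    refine (norm_add_le _ _).trans ?_
    rw [norm_mul, hw, one_mul]
    push_cast
    linarith

theorem exists_circle_net {ε : ℝ} (hε : 0 < ε) :
    ∃ M : ℕ, 0 < M ∧ ∃ d : ℕ → ℂ, (∀ k, ‖d k‖ = 1) ∧
      ∀ w : ℂ, ‖w‖ = 1 → ∃ k < M, ‖w - d k‖ ≤ ε := by
  obtain ⟨t, hts, htf, ht⟩ := (isCompact_sphere (0 : ℂ) 1).finite_cover_balls hε
  set l := htf.toFinset.toList
  have hl : ∀ x ∈ l, ‖x‖ = 1 := fun x hx => by simpa using hts (by simpa [l] using hx)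
  -- The default value `1` keeps every `d k` on the circle; the extra index makes `M` positive at
  -- once.
  refine ⟨l.length + 1, Nat.succ_pos _, fun k => l.getD k 1, fun k => ?_, fun w hw => ?_⟩
  · beta_reduce
    by_cases hk : k < l.length
    · rw [List.getD_eq_getElem _ _ hk]
      exact hl _ (List.getElem_mem hk)
    · rw [List.getD_eq_default _ _ (not_lt.1 hk), norm_one]
  · have := ht (show w ∈ Metric.sphere (0 : ℂ) 1 by simpa using hw)
    simp only [Set.mem_iUnion, exists_prop] at this
    obtain ⟨x, hx, hwx⟩ := this
    have hxl : x ∈ l := by simpa [l] using hx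
    obtain ⟨k, hk, rfl⟩ := List.getElem_of_mem hxl
    refine ⟨k, Nat.lt_succ_of_lt hk, ?_⟩
    beta_reduce
    rw [List.getD_eq_getElem _ _ hk, ← dist_eq_norm]
    exact (Metric.mem_ball.1 hwx).le

/-- There is a finite sequence of phases that corrects every geometric sequence of phases at some
index, with any prescribed accuracy. -/
theorem exists_phases {ε : ℝ} (hε : 0 < ε) :
    ∃ L : ℕ, 0 < L ∧ ∃ c : ℕ → ℂ, (∀ l, ‖c l‖ = 1) ∧
      ∀ u v : ℂ, ‖u‖ = 1 → ‖v‖ = 1 → ∃ l < L, ‖u * v ^ l * c l - 1‖ ≤ ε := by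
  obtain ⟨M, hM, d, hd, hdn⟩ := exists_circle_net (half_pos hε)
  have hM' : (0 : ℝ) < M := by exact_mod_cast hM
  obtain ⟨P, hP, p, hp, hpn⟩ := exists_circle_net (ε := ε / (2 * M)) (by positivity)
  -- The index is read as `l = iM + k`: the block `i` guesses `v ≈ p i`, and the position `k`
  -- guesses `u v^{iM} ≈ d k`. The first guess is raised to a power `k < M`, hence its accuracy `ε /
  -- (2M)`.
  refine ⟨P * M, Nat.mul_pos hP hM, fun l => (p (l / M) ^ (l % M))⁻¹ * (d (l % M))⁻¹, ?_, ?_⟩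
  · intro l
    simp [hd, hp]
  · intro u v hu hv
    obtain ⟨i, hi, hvi⟩ := hpn v hv
    obtain ⟨k, hk, huk⟩ := hdn (u * v ^ (i * M)) (by simp [hu, hv])
    have hpi : p i ≠ 0 := norm_pos_iff.1 (by rw [hp]; exact one_pos)
    have hdk : d k ≠ 0 := norm_pos_iff.1 (by rw [hd]; exact one_pos)
    refine ⟨i * M + k, ?_, ?_⟩
    · calc i * M + k < i * M + M := by omega
        _ = (i + 1) * M := by ring
        _ ≤ P * M := Nat.mul_le_mul_right _ hi
    · have h1 : (i * M + k) / M = i := by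
        rw [mul_comm, Nat.mul_add_div hM, Nat.div_eq_of_lt hk, add_zero]
      have h2 : (i * M + k) % M = k := by
        rw [mul_comm, Nat.mul_add_mod, Nat.mod_eq_of_lt hk]
      simp only [h1, h2]
      have hw : ‖v / p i‖ = 1 := by rw [norm_div, hv, hp, div_one]
      have hid : u * v ^ (i * M + k) * ((p i ^ k)⁻¹ * (d k)⁻¹) - 1 =
          (u * v ^ (i * M)) * (d k)⁻¹ * ((v / p i) ^ k - 1) +
            (u * v ^ (i * M) - d k) * (d k)⁻¹ := by
        rw [pow_add, div_pow]
        field_simp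
        ring
      rw [hid]
      refine (norm_add_le _ _).trans ?_
      rw [norm_mul, norm_mul, norm_mul, norm_mul, norm_inv, hd, norm_pow, hu, hv]
      have h3 := norm_pow_sub_one_le hw k
      have h4 : ‖v / p i - 1‖ ≤ ε / (2 * M) := by
        have : v / p i - 1 = (v - p i) / p i := by field_simp
        rw [this, norm_div, hp, div_one]
        exact hvi
      have h5 : (k : ℝ) * ‖v / p i - 1‖ ≤ M * (ε / (2 * M)) := by
        have : (k : ℝ) ≤ M := by exact_mod_cast hk.le
        gcongr
      have h6 : (M : ℝ) * (ε / (2 * M)) = ε / 2 := by field_simp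
      simp only [one_pow, inv_one, mul_one, one_mul]
      linarith

/-- A slowly decreasing sequence of logarithmic radii `ρ`, together with the logarithmic moduli `m`
that make `n ↦ n ρ n` concave with slopes `-m`, on a finite set of large indices. -/
theorem exists_radii (s₀ : ℝ) {δ₀ : ℝ} (hδ₀ : 0 < δ₀) {N L : ℕ} (hN : 0 < N) (hL : 0 < L)
    {η : ℝ} (hη : 0 < η) :
    ∃ δ > 0, ∀ A : ℕ, ∃ (K : Finset ℕ) (ρ m : ℕ → ℝ), (∀ k ∈ K, A ≤ k) ∧
      (∀ k ∈ K, |m k + s₀| < δ₀) ∧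
      (∀ k ∈ K, ∀ j : ℕ, j * ρ j - k * ρ k + (j - k) * m k ≤ 0) ∧
      ∀ s, |s - s₀| ≤ δ → ∃ i, ∀ l < L,
        i * L + l ∈ K ∧ |(N : ℝ) * (i * L + l : ℕ) * (s - ρ (i * L + l))| ≤ η := by
  -- On `K` the values of `ρ` lie in `[s₀ - 2δ, s₀ + δ]` and `κ ≤ δ`, so `m = κ - ρ` stays within
  -- `3δ < δ₀` of `-s₀`.
  set δ := δ₀ / 8 with hδ
  have hδpos : 0 < δ := by positivity
  have hNpos : (0 : ℝ) < N := by exact_mod_cast hN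
  have hLpos : (0 : ℝ) < L := by exact_mod_cast hL
  set κ := min δ (η / (2 * N * L)) with hκ
  have hκpos : 0 < κ := by positivity
  have hκδ : κ ≤ δ := min_le_left _ _
  have hκη : 2 * N * L * κ ≤ η := by
    calc 2 * N * L * κ ≤ 2 * N * L * (η / (2 * N * L)) := by gcongr; exact min_le_right _ _
      _ = η := by field_simp
  refine ⟨δ, hδpos, fun A => ?_⟩
  set B := (A + 1) * L with hB
  have hBpos : 0 < B := by positivity
  have hBR : (0 : ℝ) < B := by exact_mod_cast hBpos
  -- The logarithm is unbounded, so `ρ` sweeps the whole interval, but it drops by at most `κ / i`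
  -- across the `i`-th block; multiplied by `Nk ≤ 2NiL`, this is at most `2NLκ ≤ η`.
  let ρ : ℕ → ℝ := fun k => s₀ + δ - κ * (Real.log k - Real.log B)
  have hanti : ∀ a b : ℕ, 0 < a → a ≤ b → ρ b ≤ ρ a := by
    intro a b ha hab
    have : Real.log a ≤ Real.log b :=
      Real.log_le_log (by exact_mod_cast ha) (by exact_mod_cast hab)
    simp only [ρ]
    gcongr
  have hρB : ρ B = s₀ + δ := by simp [ρ]
  -- The range bound only makes `K` finite: it follows from `s₀ - 2δ ≤ ρ k`.
  let K : Finset ℕ := {k ∈ Finset.range (⌊B * Real.exp (3 * δ / κ)⌋₊ + 1) |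
    B ≤ k ∧ s₀ - 2 * δ ≤ ρ k}
  have hK : ∀ k, B ≤ k → s₀ - 2 * δ ≤ ρ k → k ∈ K := by
    intro k hk hk'
    refine Finset.mem_filter.2 ⟨Finset.mem_range.2 (Nat.lt_succ_of_le (Nat.le_floor ?_)), hk, hk'⟩
    have hkpos : (0 : ℝ) < k := by exact_mod_cast hBpos.trans_le hk
    have h1 : Real.log k ≤ Real.log B + 3 * δ / κ := by
      have : κ * (Real.log k - Real.log B) ≤ 3 * δ := by simp only [ρ] at hk'; linarith
      have : Real.log k - Real.log B ≤ 3 * δ / κ := by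
        rw [le_div_iff₀ hκpos]; linarith
      linarith
    calc (k : ℝ) = Real.exp (Real.log k) := (Real.exp_log hkpos).symm
      _ ≤ Real.exp (Real.log B + 3 * δ / κ) := Real.exp_le_exp.2 h1
      _ = B * Real.exp (3 * δ / κ) := by rw [Real.exp_add, Real.exp_log hBR]
  refine ⟨K, ρ, fun k => κ - ρ k, fun k hk => ?_, fun k hk => ?_, fun k hk j => ?_,
    fun s hs => ?_⟩
  · have := (Finset.mem_filter.1 hk).2.1
    have h2 : A + 1 ≤ B := Nat.le_mul_of_pos_right _ hL
    omega
  · obtain ⟨-, h1, h2⟩ := Finset.mem_filter.1 hk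
    have h3 := hanti B k hBpos h1
    rw [abs_lt]
    constructor <;> linarith
  · have h1 : B ≤ k := (Finset.mem_filter.1 hk).2.1
    have hkpos : (0 : ℝ) < k := by exact_mod_cast hBpos.trans_le h1
    have hid : j * ρ j - k * ρ k + ((j : ℝ) - k) * (κ - ρ k) =
        κ * (j * (Real.log k - Real.log j) + j - k) := by
      simp only [ρ]; ring
    rw [hid]
    refine mul_nonpos_of_nonneg_of_nonpos hκpos.le ?_
    rcases Nat.eq_zero_or_pos j with rfl | hj
    · simp
    · have hjpos : (0 : ℝ) < j := by exact_mod_cast hj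
      -- Concavity of `n ↦ nρ_n`: its derivative is `ρ - κ = -m`, and the tangent-line inequality at
      -- `k` reduces to `log x ≤ x - 1` for `x = k / j`.
      have h2 := Real.log_le_sub_one_of_pos (div_pos hkpos hjpos)
      rw [Real.log_div hkpos.ne' hjpos.ne'] at h2
      have h3 : j * (Real.log k - Real.log j) ≤ j * ((k : ℝ) / j - 1) := by gcongr
      have h4 : (j : ℝ) * ((k : ℝ) / j - 1) = k - j := by field_simp
      linarith
  · rw [abs_le] at hs
    -- Discrete intermediate value: `ρ` starts at `s₀ + δ ≥ s` and eventually falls below `s`.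
    have hex : ∃ i, A + 1 ≤ i ∧ s ≤ ρ (i * L) ∧ ρ ((i + 1) * L) < s := by
      by_contra! h
      have hall : ∀ i, A + 1 ≤ i → s ≤ ρ (i * L) := by
        intro i hi
        induction i, hi using Nat.le_induction with
        | base => rw [← hB, hρB]; linarith
        | succ i hi ih => exact h i hi ih
      obtain ⟨n, hn⟩ := exists_nat_gt (B * Real.exp (3 * δ / κ))
      set i := max n (A + 1)
      have h1 := hall i (le_max_right _ _)
      have hipos : (0 : ℝ) < (i * L : ℕ) := by
        have : 0 < i := lt_of_lt_of_le (Nat.succ_pos A) (le_max_right _ _)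
        exact_mod_cast Nat.mul_pos this hL
      have h2 : B * Real.exp (3 * δ / κ) ≤ (i * L : ℕ) := by
        refine hn.le.trans ?_
        exact_mod_cast (le_max_left n (A + 1)).trans (Nat.le_mul_of_pos_right _ hL)
      have h3 := Real.log_le_log (by positivity) h2
      rw [Real.log_mul hBR.ne' (Real.exp_pos _).ne', Real.log_exp] at h3
      have h4 : κ * (3 * δ / κ) ≤ κ * (Real.log (i * L : ℕ) - Real.log B) := by
        gcongr; linarith
      have h5 : κ * (3 * δ / κ) = 3 * δ := by field_simp
      simp only [ρ] at h1
      linarith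
    obtain ⟨i, hi, h1, h2⟩ := hex
    refine ⟨i, fun l hl => ?_⟩
    have hipos : 0 < i := lt_of_lt_of_le (Nat.succ_pos A) hi
    have hiR : (0 : ℝ) < i := by exact_mod_cast hipos
    have hi1 : (1 : ℝ) ≤ i := by exact_mod_cast hipos
    have hle : i * L + l ≤ (i + 1) * L := by rw [add_mul, one_mul]; omega
    have hBk : B ≤ i * L + l := (Nat.mul_le_mul_right L hi).trans (Nat.le_add_right _ _)
    have h3 := hanti (i * L) (i * L + l) (Nat.mul_pos hipos hL) (Nat.le_add_right _ _)
    have h4 := hanti (i * L + l) ((i + 1) * L) (hBpos.trans_le hBk) hle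
    have h5 : ρ (i * L) - ρ ((i + 1) * L) ≤ κ / i := by
      have hlog : Real.log ((i + 1 : ℝ) / i) ≤ 1 / i := by
        refine (Real.log_le_sub_one_of_pos (by positivity)).trans (le_of_eq ?_)
        field_simp
        ring
      have hid : ρ (i * L) - ρ ((i + 1) * L) = κ * Real.log ((i + 1 : ℝ) / i) := by
        simp only [ρ]
        push_cast
        rw [Real.log_mul hiR.ne' hLpos.ne', Real.log_mul (by positivity) hLpos.ne',
          Real.log_div (by positivity) hiR.ne']
        ring
      rw [hid, div_eq_mul_one_div κ]
      exact mul_le_mul_of_nonneg_left hlog hκpos.le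
    have h6 : |s - ρ (i * L + l)| ≤ κ / i := by
      rw [abs_le]; constructor <;> linarith
    have h7 : κ / i ≤ κ := div_le_self hκpos.le hi1
    refine ⟨hK _ hBk ?_, ?_⟩
    · have := (abs_le.1 h6).2
      linarith
    · have h8 : ((i * L + l : ℕ) : ℝ) ≤ 2 * i * L := by
        calc ((i * L + l : ℕ) : ℝ) ≤ ((i + 1) * L : ℕ) := by exact_mod_cast hle
          _ = (i + 1) * L := by push_cast; ring
          _ ≤ (i + i) * L := by gcongr
          _ = 2 * i * L := by ring
      rw [abs_mul, abs_of_nonneg (by positivity)]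
      calc (N : ℝ) * (i * L + l : ℕ) * |s - ρ (i * L + l)| ≤ N * (2 * i * L) * (κ / i) := by gcongr
        _ = 2 * N * L * κ := by field_simp
        _ ≤ η := hκη

end Numbers

/-! ### Quadratic decay of weighted exponential sums. -/

section SecondDifference

open Metric

/-- Two Cauchy estimates on discs of radius `1/4` bound the second derivative by `16M` on the unit
disc; two mean value inequalities convert this into the second difference. -/
theorem norm_second_difference_le {h : ℂ → ℂ} {M : ℝ} (hd : DifferentiableOn ℂ h (ball 0 2))
    (hM : ∀ w ∈ ball (0 : ℂ) 2, ‖h w‖ ≤ M) {t d : ℝ} (hd0 : 0 ≤ d) (h0 : 0 ≤ t - d)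
    (h1 : t + d ≤ 1) :
    ‖h (t + d : ℝ) - 2 * h t + h (t - d : ℝ)‖ ≤ 16 * M * d ^ 2 := by
  have hd1 : ∀ w ∈ ball (0 : ℂ) (3 / 2), ‖deriv h w‖ ≤ 4 * M := by
    intro w hw
    rw [mem_ball_zero_iff] at hw
    have hsub : closedBall w (1 / 4) ⊆ ball 0 2 := fun v hv => by
      rw [mem_closedBall, dist_eq_norm] at hv
      rw [mem_ball_zero_iff]
      have := norm_le_insert' v w
      linarith
    have := Complex.norm_deriv_le_of_forall_mem_sphere_norm_le (c := w) (R := 1 / 4) (f := h) (C := M)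
      (by norm_num) (hd.diffContOnCl_ball hsub)
      (fun v hv => hM v (hsub (sphere_subset_closedBall hv)))
    linarith
  have hdd : DifferentiableOn ℂ (deriv h) (ball 0 2) := hd.deriv isOpen_ball
  have hd2 : ∀ w ∈ closedBall (0 : ℂ) 1, ‖deriv (deriv h) w‖ ≤ 16 * M := by
    intro w hw
    rw [mem_closedBall_zero_iff] at hw
    have hsub : closedBall w (1 / 4) ⊆ ball 0 (3 / 2) := fun v hv => by
      rw [mem_closedBall, dist_eq_norm] at hv
      rw [mem_ball_zero_iff]
      have := norm_le_insert' v w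
      linarith
    have := Complex.norm_deriv_le_of_forall_mem_sphere_norm_le (c := w) (R := 1 / 4) (f := deriv h)
      (C := 4 * M) (by norm_num)
      ((hdd.mono (ball_subset_ball (by norm_num))).diffContOnCl_ball hsub)
      (fun v hv => hd1 v (hsub (sphere_subset_closedBall hv)))
    linarith
  have hball : ∀ w ∈ closedBall (0 : ℂ) 1, w ∈ ball (0 : ℂ) 2 := fun w hw =>
    closedBall_subset_ball (by norm_num) hw
  have hda : ∀ w ∈ closedBall (0 : ℂ) 1, DifferentiableAt ℂ h w := fun w hw =>
    hd.differentiableAt (isOpen_ball.mem_nhds (hball w hw))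
  have hdda : ∀ w ∈ closedBall (0 : ℂ) 1, DifferentiableAt ℂ (deriv h) w := fun w hw =>
    hdd.differentiableAt (isOpen_ball.mem_nhds (hball w hw))
  set S : Set ℂ := segment ℝ ((t - d : ℝ) : ℂ) (t : ℂ)
  have hreal : ∀ x : ℝ, 0 ≤ x → x ≤ 1 → (x : ℂ) ∈ closedBall (0 : ℂ) 1 := fun x hx0 hx1 => by
    rw [mem_closedBall_zero_iff, Complex.norm_real, Real.norm_eq_abs, abs_of_nonneg hx0]
    exact hx1
  have hS : S ⊆ closedBall 0 1 := (convex_closedBall 0 1).segment_subset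
    (hreal _ h0 (by linarith)) (hreal _ (by linarith) (by linarith))
  have hSd : ∀ w ∈ S, w + d ∈ closedBall (0 : ℂ) 1 := by
    have : S ⊆ (fun w : ℂ => w + d) ⁻¹' closedBall 0 1 := by
      refine ((convex_closedBall (0 : ℂ) 1).translate_preimage_left _).segment_subset ?_ ?_
      · change ((t - d : ℝ) : ℂ) + d ∈ closedBall (0 : ℂ) 1
        rw [← Complex.ofReal_add]
        exact hreal _ (by linarith) (by linarith)
      · change (t : ℂ) + d ∈ closedBall (0 : ℂ) 1
        rw [← Complex.ofReal_add]
        exact hreal _ (by linarith) (by linarith)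
    exact fun w hw => this hw
  have hk : ∀ w ∈ S, HasDerivWithinAt (fun w => h (w + d) - h w)
      (deriv h (w + d) - deriv h w) S w := fun w hw =>
    (((hda _ (hSd w hw)).hasDerivAt.comp_add_const w (d : ℂ)).sub
      (hda w (hS hw)).hasDerivAt).hasDerivWithinAt
  have hk' : ∀ w ∈ S, ‖deriv h (w + d) - deriv h w‖ ≤ 16 * M * d := by
    intro w hw
    have := (convex_closedBall (0 : ℂ) 1).norm_image_sub_le_of_norm_deriv_le hdda hd2 (hS hw)
      (hSd w hw)
    simpa [abs_of_nonneg hd0] using this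
  have := (convex_segment _ _).norm_image_sub_le_of_norm_hasDerivWithin_le hk hk'
    (left_mem_segment ℝ _ _) (right_mem_segment ℝ _ _)
  have hn : ‖(t : ℂ) - ((t - d : ℝ) : ℂ)‖ = d := by
    rw [← Complex.ofReal_sub, Complex.norm_real, Real.norm_eq_abs, abs_of_nonneg] <;> linarith
  rw [hn] at this
  calc _ = ‖h (t + d) - h t - (h ((t - d : ℝ) + d) - h ((t - d : ℝ) : ℂ))‖ := by
        congr 1; push_cast; ring_nf
    _ ≤ 16 * M * d * d := this
    _ = _ := by ring

/-- Summation by parts twice, with all boundary terms kept. -/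
theorem sum_mul_one_sub_sq (a : ℕ → ℂ) (ζ : ℂ) (m : ℕ) :
    (1 - ζ) ^ 2 * ∑ q ∈ Finset.range (m + 2), a q * ζ ^ q =
      a 0 + (a 1 - 2 * a 0) * ζ +
      ∑ q ∈ Finset.range m, (a (q + 2) - 2 * a (q + 1) + a q) * ζ ^ (q + 2) +
      (a m - 2 * a (m + 1)) * ζ ^ (m + 2) + a (m + 1) * ζ ^ (m + 3) := by
  induction m with
  | zero => simp [Finset.sum_range_succ]; ring
  | succ m ih =>
    rw [Finset.sum_range_succ, mul_add, ih, Finset.sum_range_succ _ m]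
    ring

theorem half_norm_le_norm_one_sub_exp {θ : ℝ} (hθ : |θ| ≤ 1 / 2) :
    |θ| / 2 ≤ ‖1 - Complex.exp (θ * Complex.I)‖ := by
  have hn : ‖(θ : ℂ) * Complex.I‖ = |θ| := by simp
  have h := Complex.norm_exp_sub_one_sub_id_le (x := θ * Complex.I) (by rw [hn]; linarith)
  rw [hn] at h
  have h2 := norm_sub_norm_le ((θ : ℂ) * Complex.I) (θ * Complex.I - (Complex.exp (θ * Complex.I) - 1))
  rw [hn, sub_sub_cancel, norm_sub_rev _ (1 : ℂ), norm_sub_rev (θ * Complex.I)] at h2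
  have h3 : |θ| ^ 2 ≤ |θ| * (1 / 2) := by rw [sq]; gcongr
  linarith

/-- The polynomial weight `t² (1 - t)²`. -/
def bumpWeight (t : ℝ) : ℝ := t ^ 2 * (1 - t) ^ 2

/-- The total weight is at least proportional to `Q`, so normalising cancels the factor `Q` in the
decay estimate. -/
theorem sum_bumpWeight_ge {Q : ℕ} (hQ : 2 ≤ Q) :
    (Q : ℝ) / 60 ≤ ∑ q ∈ Finset.range (Q + 1), bumpWeight (q / Q) := by
  have hQR : (2 : ℝ) ≤ Q := by exact_mod_cast hQ
  have hid : ∀ (c : ℝ) (n : ℕ), ∑ q ∈ Finset.range (n + 1), (q : ℝ) ^ 2 * (c - q) ^ 2 =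
      c ^ 2 * (n * (n + 1) * (2 * n + 1) / 6) - 2 * c * (n * (n + 1) / 2) ^ 2 +
        n * (n + 1) * (2 * n + 1) * (3 * n ^ 2 + 3 * n - 1) / 30 := by
    intro c n
    induction n with
    | zero => simp
    | succ n ih =>
      rw [Finset.sum_range_succ, ih]
      push_cast
      ring
  have h1 : ∑ q ∈ Finset.range (Q + 1), bumpWeight (q / Q) = (Q * (Q ^ 4 - 1) / 30) / (Q : ℝ) ^ 4 := by
    have := hid Q Q
    have h2 : ∑ q ∈ Finset.range (Q + 1), bumpWeight (q / Q) =
        (∑ q ∈ Finset.range (Q + 1), (q : ℝ) ^ 2 * (Q - q) ^ 2) / (Q : ℝ) ^ 4 := by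
      rw [Finset.sum_div]
      refine Finset.sum_congr rfl fun q _ => ?_
      simp only [bumpWeight]
      field_simp
    rw [h2, this]
    congr 1
    ring
  rw [h1, le_div_iff₀ (by positivity)]
  have h4 : (2 : ℝ) ≤ Q ^ 4 := by
    calc (2 : ℝ) ≤ 2 ^ 4 := by norm_num
      _ ≤ Q ^ 4 := by gcongr
  have : (Q : ℝ) * 2 ≤ Q * Q ^ 4 := by gcongr
  nlinarith

/-- Quadratic decay of the weighted exponential sums of a bounded holomorphic function. -/
theorem norm_sum_bumpWeight_le {F : ℂ → ℂ} {M : ℝ} (hF : DifferentiableOn ℂ F (ball 0 2))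
    (hM : ∀ w ∈ ball (0 : ℂ) 2, ‖F w‖ ≤ M) {η : ℝ} (hη : 0 < η) (hη2 : η ≤ 1 / 2)
    {Q : ℕ} (hQ : 2 ≤ Q) {n : ℤ} (hn : |n| ≤ Q) :
    ‖∑ q ∈ Finset.range (Q + 1), (bumpWeight (q / Q) : ℂ) * F ((q / Q : ℝ) : ℂ) *
        Complex.exp ((η * n / Q : ℝ) * Complex.I) ^ q‖ * (1 + (n : ℝ) ^ 2) ≤
      Q * (M * (2 + 4608 / η ^ 2)) := by
  obtain ⟨m, rfl⟩ : ∃ m, Q = m + 1 := ⟨Q - 1, by omega⟩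
  set Q := m + 1 with hQdef
  have hQR : (2 : ℝ) ≤ Q := by exact_mod_cast hQ
  have hM0 : 0 ≤ M := (norm_nonneg _).trans (hM 0 (by simp))
  have hunit : ∀ q ∈ Finset.range (Q + 1), 0 ≤ (q / Q : ℝ) ∧ (q / Q : ℝ) ≤ 1 := fun q hq => by
    have : (q : ℝ) ≤ Q := by exact_mod_cast Nat.lt_succ_iff.1 (Finset.mem_range.1 hq)
    exact ⟨by positivity, div_le_one_of_le₀ this (by positivity)⟩
  have hreal : ∀ x : ℝ, 0 ≤ x → x ≤ 1 → (x : ℂ) ∈ ball (0 : ℂ) 2 := fun x hx0 hx1 => by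
    rw [mem_ball_zero_iff, Complex.norm_real, Real.norm_eq_abs, abs_of_nonneg hx0]
    linarith
  set ζ := Complex.exp ((η * n / Q : ℝ) * Complex.I) with hζ
  have hζ1 : ‖ζ‖ = 1 := Complex.norm_exp_ofReal_mul_I _
  let h : ℂ → ℂ := fun w => w ^ 2 * (1 - w) ^ 2 * F w
  have hh : ∀ x : ℝ, (bumpWeight x : ℂ) * F x = h x := fun x => by
    simp [h, bumpWeight]
  set a : ℕ → ℂ := fun q => h ((q / Q : ℝ) : ℂ) with ha
  set S := ∑ q ∈ Finset.range (Q + 1), a q * ζ ^ q with hS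
  have hsum : ∑ q ∈ Finset.range (Q + 1), (bumpWeight (q / Q) : ℂ) * F ((q / Q : ℝ) : ℂ) * ζ ^ q
      = S := Finset.sum_congr rfl fun q _ => by rw [hh]
  rw [hsum]
  have hhd : DifferentiableOn ℂ h (ball 0 2) := by
    refine DifferentiableOn.mul ?_ hF
    exact (by fun_prop : Differentiable ℂ fun w : ℂ => w ^ 2 * (1 - w) ^ 2).differentiableOn
  have hhM : ∀ w ∈ ball (0 : ℂ) 2, ‖h w‖ ≤ 36 * M := by
    intro w hw
    have h1 := hM w hw
    rw [mem_ball_zero_iff] at hw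
    have h2 : ‖1 - w‖ ≤ 3 := by
      have := norm_sub_le (1 : ℂ) w
      rw [norm_one] at this
      linarith
    simp only [h, norm_mul, norm_pow]
    calc ‖w‖ ^ 2 * ‖1 - w‖ ^ 2 * ‖F w‖ ≤ 2 ^ 2 * 3 ^ 2 * M := by gcongr
      _ = 36 * M := by ring
  -- The double zeros at `0` and `1` make the boundary values `a 1` and `a m` of order `1 / Q²`,
  -- like the second differences.
  have hweight : ∀ x : ℝ, 0 ≤ x → x ≤ 1 → ‖h x‖ ≤ x ^ 2 * M ∧ ‖h x‖ ≤ (1 - x) ^ 2 * M := by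
    intro x hx0 hx1
    have h1 := hM x (hreal x hx0 hx1)
    have h2 : x ^ 2 ≤ 1 := pow_le_one₀ hx0 hx1
    have h3 : (1 - x) ^ 2 ≤ 1 := pow_le_one₀ (by linarith) (by linarith)
    have h4 : ‖h x‖ = x ^ 2 * (1 - x) ^ 2 * ‖F x‖ := by
      have h5 : ‖(1 : ℂ) - x‖ = 1 - x := by
        rw [← Complex.ofReal_one, ← Complex.ofReal_sub, Complex.norm_real, Real.norm_eq_abs,
          abs_of_nonneg (by linarith)]
      simp only [h, norm_mul, norm_pow, h5, Complex.norm_real, Real.norm_eq_abs, abs_of_nonneg hx0]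
    rw [h4]
    constructor
    · calc x ^ 2 * (1 - x) ^ 2 * ‖F x‖ ≤ x ^ 2 * 1 * M := by gcongr
        _ = x ^ 2 * M := by ring
    · calc x ^ 2 * (1 - x) ^ 2 * ‖F x‖ ≤ 1 * (1 - x) ^ 2 * M := by gcongr
        _ = (1 - x) ^ 2 * M := by ring
  have hSQ : ‖S‖ ≤ Q * (2 * M) := by
    refine (norm_sum_le _ _).trans ?_
    calc ∑ q ∈ Finset.range (Q + 1), ‖a q * ζ ^ q‖ ≤ ∑ q ∈ Finset.range (Q + 1), M := by
          refine Finset.sum_le_sum fun q hq => ?_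
          obtain ⟨hq0, hq1⟩ := hunit q hq
          rw [norm_mul, norm_pow, hζ1, one_pow, mul_one]
          refine (hweight _ hq0 hq1).1.trans ?_
          exact mul_le_of_le_one_left hM0 (pow_le_one₀ hq0 hq1)
      _ = (Q + 1) * M := by simp
      _ ≤ Q * (2 * M) := by nlinarith
  -- The `m` second differences and two boundary terms are each at most `576M / Q²`, where `576 = 16
  -- * 36`; there are `Q + 1 ≤ 2Q` of them.
  have hS2 : ‖(1 - ζ) ^ 2 * S‖ ≤ 1152 * M / Q := by
    have ha0 : a 0 = 0 := by simp [a, h]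
    have hQ0 : (Q : ℝ) ≠ 0 := by positivity
    have haQ : a (m + 1) = 0 := by simp [a, h, ← hQdef]
    have hQm : (Q : ℝ) = m + 1 := by rw [hQdef]; push_cast; ring
    have ha1 : ‖a 1‖ ≤ 576 * M / Q ^ 2 := by
      obtain ⟨h0, h1⟩ := hunit 1 (Finset.mem_range.2 (by omega))
      refine (hweight _ h0 h1).1.trans ?_
      rw [Nat.cast_one, div_pow, one_pow, div_mul_eq_mul_div, one_mul]
      gcongr
      linarith
    have ham : ‖a m‖ ≤ 576 * M / Q ^ 2 := by
      obtain ⟨h0, h1⟩ := hunit m (Finset.mem_range.2 (by omega))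
      refine (hweight _ h0 h1).2.trans ?_
      have : 1 - (m : ℝ) / Q = 1 / Q := by rw [hQm] at hQ0 ⊢; field_simp; ring
      rw [this, div_pow, one_pow, div_mul_eq_mul_div, one_mul]
      gcongr
      linarith
    have had : ∀ q ∈ Finset.range m, ‖a (q + 2) - 2 * a (q + 1) + a q‖ ≤ 576 * M / Q ^ 2 := by
      intro q hq
      have hqm : (q : ℝ) + 2 ≤ Q := by
        have := Finset.mem_range.1 hq
        exact_mod_cast (by omega : q + 2 ≤ Q)
      have h1 := norm_second_difference_le hhd hhM (t := (q + 1) / Q) (d := 1 / Q) (by positivity)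
        (by rw [← sub_div]; exact div_nonneg (by linarith [q.cast_nonneg (α := ℝ)]) (by positivity))
        (by rw [← add_div]; exact div_le_one_of_le₀ (by linarith) (by positivity))
      have e1 : ((q : ℝ) + 1) / Q + 1 / Q = ((q + 2 : ℕ) : ℝ) / Q := by push_cast; ring
      have e2 : ((q : ℝ) + 1) / Q - 1 / Q = (q : ℝ) / Q := by ring
      have e3 : ((q : ℝ) + 1) / Q = ((q + 1 : ℕ) : ℝ) / Q := by push_cast; ring
      rw [e1, e2, e3] at h1
      refine h1.trans (le_of_eq ?_)
      rw [div_pow, one_pow]; ring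
    rw [hS, hQdef, sum_mul_one_sub_sq a ζ m, ha0, haQ]
    simp only [mul_zero, sub_zero, zero_add, zero_mul, add_zero]
    refine (norm_add_le _ _).trans ((add_le_add (norm_add_le _ _) le_rfl).trans ?_)
    simp only [norm_mul, norm_pow, hζ1, one_pow, mul_one]
    have hsum2 : ‖∑ q ∈ Finset.range m, (a (q + 2) - 2 * a (q + 1) + a q) * ζ ^ (q + 2)‖ ≤
        m * (576 * M / Q ^ 2) := by
      refine (norm_sum_le _ _).trans ?_
      calc _ ≤ ∑ q ∈ Finset.range m, 576 * M / (Q : ℝ) ^ 2 := by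
            refine Finset.sum_le_sum fun q hq => ?_
            rw [norm_mul, norm_pow, hζ1, one_pow, mul_one]
            exact had q hq
        _ = _ := by simp
    calc _ ≤ 576 * M / (Q : ℝ) ^ 2 + m * (576 * M / Q ^ 2) + 576 * M / Q ^ 2 :=
          add_le_add (add_le_add ha1 hsum2) ham
      _ = (Q + 1) * (576 * M / Q ^ 2) := by rw [hQm]; ring
      _ ≤ (2 * Q) * (576 * M / Q ^ 2) := by gcongr; linarith
      _ = 1152 * M / (m + 1 : ℕ) := by rw [← hQdef]; field_simp; ring
  -- Here `|n| ≤ Q` is essential: the discrete sum is periodic in the angle, so decay holds only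
  -- while `ζ` stays away from a full turn.
  have hθ : |η * n / Q| ≤ 1 / 2 := by
    have : |(n : ℝ)| ≤ Q := by exact_mod_cast hn
    rw [abs_div, abs_mul, abs_of_pos hη, abs_of_pos (by positivity : (0 : ℝ) < Q),
      div_le_iff₀ (by positivity)]
    gcongr
  have hlow := half_norm_le_norm_one_sub_exp hθ
  have hlow2 : (η * n / Q) ^ 2 / 4 ≤ ‖1 - ζ‖ ^ 2 := by
    calc (η * n / Q) ^ 2 / 4 = (|η * n / Q| / 2) ^ 2 := by rw [div_pow _ (2 : ℝ), sq_abs]; norm_num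
      _ ≤ _ := by gcongr
  rw [norm_mul, norm_pow] at hS2
  have hmain : (η * n / Q) ^ 2 / 4 * ‖S‖ ≤ 1152 * M / Q :=
    (mul_le_mul_of_nonneg_right hlow2 (norm_nonneg _)).trans hS2
  have hmain2 : ‖S‖ * (n : ℝ) ^ 2 ≤ Q * (M * (4608 / η ^ 2)) := by
    have e : ‖S‖ * (n : ℝ) ^ 2 = ((η * n / Q) ^ 2 / 4 * ‖S‖) * (4 * Q ^ 2 / η ^ 2) := by
      field_simp
    rw [e]
    calc _ ≤ (1152 * M / Q) * (4 * Q ^ 2 / η ^ 2) := by gcongr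
      _ = _ := by field_simp; ring
  calc ‖S‖ * (1 + (n : ℝ) ^ 2) = ‖S‖ + ‖S‖ * (n : ℝ) ^ 2 := by ring
    _ ≤ Q * (2 * M) + Q * (M * (4608 / η ^ 2)) := add_le_add hSQ hmain2
    _ = _ := by ring

end SecondDifference

/-! ### Bilateral orbits with quadratic decay, and vectors with small orbits. -/

namespace EntireSpace

open Filter Metric

theorem eventually_norm_expFun_sub_le (a : ℂ) (R : ℝ) {ε : ℝ} (hε : 0 < ε) :
    ∀ᶠ l in 𝓝 a, ∀ z, ‖z‖ ≤ R → ‖expFun l z - expFun a z‖ ≤ ε := by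
  have h : ∀ᶠ l in 𝓝 a, ∀ z ∈ closedBall (0 : ℂ) R, ‖expFun l z - expFun a z‖ < ε := by
    refine (isCompact_closedBall (0 : ℂ) R).eventually_forall_of_forall_eventually fun z _ => ?_
    have hc : Continuous fun p : ℂ × ℂ => ‖expFun p.1 p.2 - expFun a p.2‖ := by
      simp only [expFun_apply]
      fun_prop
    exact (hc.tendsto (a, z)).eventually_lt_const (by simpa using hε)
  filter_upwards [h] with l hl z hz using (hl z (by simpa using hz)).le

/-- The vectors that are approximated by members of bilateral orbits of `T` whose moduli, after
rescaling by any factor close to `exp s₀`, decay quadratically in both directions. -/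
def HasDecayingOrbits (T : EntireSpace →L[ℂ] EntireSpace) (s₀ : ℝ) (y : EntireSpace) : Prop :=
  ∀ R > 0, ∀ ε > 0, ∃ δ > 0, ∃ Y : ℕ → ℝ → ℤ → EntireSpace,
    (∀ Q m n, |m + s₀| < δ → T (Y Q m n) = Y Q m (n + 1)) ∧
    (∀ R' > 0, ∃ C > 0, ∀ (Q : ℕ) (m : ℝ) (n : ℤ), |m + s₀| < δ → |n| ≤ Q → ∀ z, ‖z‖ ≤ R' →
      ‖Y Q m n z‖ ≤ C * Real.exp (n * m) / (1 + (n : ℝ) ^ 2)) ∧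
    ∀ Q m, |m + s₀| < δ → ∀ z, ‖z‖ ≤ R → ‖Y Q m 0 z - y z‖ ≤ ε

theorem hasDecayingOrbits_zero (T : EntireSpace →L[ℂ] EntireSpace) (s₀ : ℝ) :
    HasDecayingOrbits T s₀ 0 := by
  intro R _ ε hε
  refine ⟨1, one_pos, fun _ _ _ => 0, fun _ _ _ _ => map_zero T, fun R' _ =>
    ⟨1, one_pos, fun Q m n _ _ z _ => ?_⟩, fun Q m _ z _ => ?_⟩
  · simp only [zero_apply, norm_zero]
    positivity
  · simpa using hε.le

theorem HasDecayingOrbits.add {T : EntireSpace →L[ℂ] EntireSpace} {s₀ : ℝ} {x y : EntireSpace}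
    (hx : HasDecayingOrbits T s₀ x) (hy : HasDecayingOrbits T s₀ y) :
    HasDecayingOrbits T s₀ (x + y) := by
  intro R hR ε hε
  obtain ⟨δ₁, hδ₁, X, hX1, hX2, hX3⟩ := hx R hR (ε / 2) (half_pos hε)
  obtain ⟨δ₂, hδ₂, Y, hY1, hY2, hY3⟩ := hy R hR (ε / 2) (half_pos hε)
  refine ⟨min δ₁ δ₂, lt_min hδ₁ hδ₂, fun Q m n => X Q m n + Y Q m n, fun Q m n hm => ?_,
    fun R' hR' => ?_, fun Q m hm z hz => ?_⟩
  · rw [map_add, hX1 Q m n (hm.trans_le (min_le_left _ _)),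
      hY1 Q m n (hm.trans_le (min_le_right _ _))]
  · obtain ⟨C₁, hC₁, h1⟩ := hX2 R' hR'
    obtain ⟨C₂, hC₂, h2⟩ := hY2 R' hR'
    refine ⟨C₁ + C₂, add_pos hC₁ hC₂, fun Q m n hm hn z hz => (norm_add_le _ _).trans ?_⟩
    rw [add_mul, add_div]
    exact add_le_add (h1 Q m n (hm.trans_le (min_le_left _ _)) hn z hz)
      (h2 Q m n (hm.trans_le (min_le_right _ _)) hn z hz)
  · have h1 := hX3 Q m (hm.trans_le (min_le_left _ _)) z hz
    have h2 := hY3 Q m (hm.trans_le (min_le_right _ _)) z hz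
    rw [add_apply, add_apply, add_sub_add_comm]
    exact (norm_add_le _ _).trans (by linarith)

theorem HasDecayingOrbits.smul {T : EntireSpace →L[ℂ] EntireSpace} {s₀ : ℝ} {y : EntireSpace}
    (c : ℂ) (hy : HasDecayingOrbits T s₀ y) : HasDecayingOrbits T s₀ (c • y) := by
  intro R hR ε hε
  obtain ⟨δ, hδ, Y, hY1, hY2, hY3⟩ := hy R hR (ε / (‖c‖ + 1)) (by positivity)
  refine ⟨δ, hδ, fun Q m n => c • Y Q m n, fun Q m n hm => ?_, fun R' hR' => ?_,
    fun Q m hm z hz => ?_⟩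
  · rw [map_smul, hY1 Q m n hm]
  · obtain ⟨C, hC, h⟩ := hY2 R' hR'
    refine ⟨(‖c‖ + 1) * C, by positivity, fun Q m n hm hn z hz => ?_⟩
    rw [smul_apply, norm_mul, mul_assoc, mul_div_assoc]
    exact mul_le_mul (by linarith) (h Q m n hm hn z hz) (norm_nonneg _) (by positivity)
  · rw [smul_apply, smul_apply, ← mul_sub, norm_mul]
    calc _ ≤ (‖c‖ + 1) * (ε / (‖c‖ + 1)) :=
          mul_le_mul (by linarith) (hY3 Q m hm z hz) (norm_nonneg _) (by positivity)
      _ = ε := by field_simp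

theorem hasDecayingOrbits_expFun {T : EntireSpace →L[ℂ] EntireSpace}
    (hT : T ∘L differentiationOp = differentiationOp ∘L T) {s₀ : ℝ} {l : ℂ}
    (hl : ‖symbol T l‖ = Real.exp (-s₀)) (hd : deriv (symbol T) l ≠ 0) :
    HasDecayingOrbits T s₀ (expFun l) := by
  intro R hR ε hε
  set θ := Complex.arg (symbol T l)
  set ζ₀ : ℂ := (-s₀ : ℝ) + θ * Complex.I with hζ₀
  have hsym : symbol T l = Complex.exp ζ₀ := by
    rw [hζ₀, Complex.exp_add, ← Complex.ofReal_exp, ← hl, Complex.norm_mul_exp_arg_mul_I]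
  obtain ⟨η₀, hη₀, ψ, hψd, hψ0, hψ⟩ := exists_log_localInverse (differentiable_symbol T) hd hsym
  have hψc : ContinuousAt ψ ζ₀ :=
    (hψd.differentiableAt (isOpen_ball.mem_nhds (mem_ball_self hη₀))).continuousAt
  have hnear : ∀ᶠ ω in 𝓝 ζ₀, (∀ z, ‖z‖ ≤ R → ‖expFun (ψ ω) z - expFun l z‖ ≤ ε) ∧
      ‖ψ ω‖ < ‖l‖ + 1 := by
    have h1 : Tendsto ψ (𝓝 ζ₀) (𝓝 l) := hψ0 ▸ hψc
    exact (h1.eventually (eventually_norm_expFun_sub_le l R hε)).and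
      (h1.norm.eventually_lt_const (by linarith))
  obtain ⟨η₁, hη₁, hball⟩ := Metric.eventually_nhds_iff_ball.1 hnear
  -- For `|t| < 2` the point `ω m t` is within `δ + 2δ < 4δ` of `ζ₀`; the bound `1/2` is required by
  -- `norm_sum_bumpWeight_le`.
  set δ := min (min η₀ η₁ / 4) (1 / 2) with hδ
  have hδpos : 0 < δ := by positivity
  have hδ₀ : 4 * δ ≤ η₀ := by
    have : δ ≤ η₀ / 4 := (min_le_left _ _).trans (by gcongr; exact min_le_left _ _)
    linarith
  have hδ₁ : 4 * δ ≤ η₁ := by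
    have : δ ≤ η₁ / 4 := (min_le_left _ _).trans (by gcongr; exact min_le_right _ _)
    linarith
  have hδ2 : δ ≤ 1 / 2 := min_le_right _ _
  -- For real `t` the path is vertical, so `|e^{nω}| = e^{nm}` exactly and only the phase `e^{iδnt}`
  -- varies.
  let ω : ℝ → ℂ → ℂ := fun m t => (m : ℂ) + θ * Complex.I + δ * Complex.I * t
  have hω : ∀ m, |m + s₀| < δ → ∀ t ∈ ball (0 : ℂ) 2, ‖ω m t - ζ₀‖ < 4 * δ := by
    intro m hm t ht
    rw [mem_ball_zero_iff] at ht
    have e : ω m t - ζ₀ = ((m + s₀ : ℝ) : ℂ) + δ * Complex.I * t := by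
      simp only [ω, hζ₀]; push_cast; ring
    have h1 : ‖((m + s₀ : ℝ) : ℂ)‖ < δ := by rwa [Complex.norm_real, Real.norm_eq_abs]
    have h2 : ‖δ * Complex.I * t‖ ≤ δ * 2 := by
      rw [norm_mul, norm_mul, Complex.norm_I, mul_one, Complex.norm_real, Real.norm_eq_abs,
        abs_of_pos hδpos]
      gcongr
    rw [e]
    have := norm_add_le ((m + s₀ : ℝ) : ℂ) (δ * Complex.I * t)
    linarith
  have hω₀ : ∀ m, |m + s₀| < δ → ∀ t ∈ ball (0 : ℂ) 2, ω m t ∈ ball ζ₀ η₀ := fun m hm t ht => by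
    rw [mem_ball, dist_eq_norm]; exact (hω m hm t ht).trans_le hδ₀
  have hω₁ : ∀ m, |m + s₀| < δ → ∀ t ∈ ball (0 : ℂ) 2, ω m t ∈ ball ζ₀ η₁ := fun m hm t ht => by
    rw [mem_ball, dist_eq_norm]; exact (hω m hm t ht).trans_le hδ₁
  have hunit : ∀ (P : ℕ), ∀ q ∈ Finset.range (P + 1), (((q / P : ℝ)) : ℂ) ∈ ball (0 : ℂ) 2 := by
    intro P q hq
    have h1 : (q : ℝ) ≤ P := by exact_mod_cast Nat.lt_succ_iff.1 (Finset.mem_range.1 hq)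
    rw [mem_ball_zero_iff, Complex.norm_real, Real.norm_eq_abs, abs_of_nonneg (by positivity)]
    exact (div_le_one_of_le₀ h1 (by positivity)).trans_lt one_lt_two
  let G : ℕ → ℝ := fun P => ∑ q ∈ Finset.range (P + 1), bumpWeight (q / P)
  have hG : ∀ Q : ℕ, ((Q + 2 : ℕ) : ℝ) / 60 ≤ G (Q + 2) := fun Q => sum_bumpWeight_ge (by omega)
  have hGpos : ∀ Q : ℕ, 0 < G (Q + 2) := fun Q => lt_of_lt_of_le (by positivity) (hG Q)
  let Z : ℕ → ℝ → ℤ → EntireSpace := fun P m n => ∑ q ∈ Finset.range (P + 1),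
    ((bumpWeight (q / P) / G P : ℝ) * Complex.exp (n * ω m ((q / P : ℝ) : ℂ))) •
      expFun (ψ (ω m ((q / P : ℝ) : ℂ)))
  -- The shift by `2` guarantees the two subdivisions that the weight estimates need. Since `φ(ψ(ω))
  -- = e^ω`, applying `T` raises `n` by one.
  refine ⟨δ, hδpos, fun Q => Z (Q + 2), fun Q m n hm => ?_, fun R' hR' => ?_,
    fun Q m hm z hz => ?_⟩
  · simp only [Z, map_sum, map_smul]
    refine Finset.sum_congr rfl fun q hq => ?_
    rw [apply_expFun hT, hψ _ (hω₀ m hm _ (hunit _ q hq)), smul_smul, mul_assoc, ← Complex.exp_add]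
    congr 3
    push_cast
    ring_nf
  · refine ⟨60 * (Real.exp ((‖l‖ + 1) * R') * (2 + 4608 / δ ^ 2)), by positivity,
      fun Q m n hm hn z hz => ?_⟩
    set P := Q + 2 with hP
    have hPpos : (0 : ℝ) < P := by rw [hP]; positivity
    have hFd : DifferentiableOn ℂ (fun t => Complex.exp (ψ (ω m t) * z)) (ball 0 2) := by
      refine DifferentiableOn.cexp (DifferentiableOn.mul_const ?_ z)
      refine hψd.comp ?_ (hω₀ m hm)
      exact (by fun_prop : Differentiable ℂ (ω m)).differentiableOn
    have hFM : ∀ t ∈ ball (0 : ℂ) 2, ‖Complex.exp (ψ (ω m t) * z)‖ ≤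
        Real.exp ((‖l‖ + 1) * R') := by
      intro t ht
      rw [Complex.norm_exp]
      refine Real.exp_le_exp.2 ((Complex.re_le_norm _).trans ?_)
      rw [norm_mul]
      have := (hball _ (hω₁ m hm t ht)).2.le
      gcongr
    have hdecay := norm_sum_bumpWeight_le hFd hFM hδpos hδ2 (Q := P) (n := n) (by omega) (by omega)
    set S := ∑ q ∈ Finset.range (P + 1), (bumpWeight (q / P) : ℂ) *
      Complex.exp (ψ (ω m ((q / P : ℝ) : ℂ)) * z) * Complex.exp ((δ * n / P : ℝ) * Complex.I) ^ q
    have hZ : Z P m n z = (G P : ℂ)⁻¹ * Complex.exp (n * m) * Complex.exp ((n * θ : ℝ) * Complex.I)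
        * S := by
      simp only [Z, S, sum_apply, smul_apply, expFun_apply]
      rw [Finset.mul_sum]
      refine Finset.sum_congr rfl fun q _ => ?_
      have e : Complex.exp (n * ω m ((q / P : ℝ) : ℂ)) = Complex.exp (n * m) *
          Complex.exp ((n * θ : ℝ) * Complex.I) *
          Complex.exp ((δ * n / P : ℝ) * Complex.I) ^ q := by
        rw [← Complex.exp_nat_mul, ← Complex.exp_add, ← Complex.exp_add]
        congr 1
        simp only [ω]
        push_cast
        ring
      rw [e]
      push_cast
      ring
    have hexp : ‖Complex.exp ((n : ℂ) * m)‖ = Real.exp (n * m) := by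
      rw [Complex.norm_exp]; simp
    rw [hZ, norm_mul, norm_mul, norm_mul, Complex.norm_exp_ofReal_mul_I, mul_one, hexp, norm_inv,
      Complex.norm_real, Real.norm_eq_abs, abs_of_pos (hGpos Q), le_div_iff₀ (by positivity)]
    have hGinv : (G P)⁻¹ ≤ 60 / P := by
      rw [← inv_div]
      exact inv_anti₀ (by positivity) (hG Q)
    calc (G P)⁻¹ * Real.exp (n * m) * ‖S‖ * (1 + (n : ℝ) ^ 2)
        = (G P)⁻¹ * Real.exp (n * m) * (‖S‖ * (1 + (n : ℝ) ^ 2)) := by ring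
      _ ≤ 60 / P * Real.exp (n * m) *
          (P * (Real.exp ((‖l‖ + 1) * R') * (2 + 4608 / δ ^ 2))) := by gcongr
      _ = _ := by field_simp
  · set P := Q + 2
    have hone : ∑ q ∈ Finset.range (P + 1), (bumpWeight (q / P) / G P) = 1 := by
      rw [← Finset.sum_div]
      exact div_self (hGpos Q).ne'
    have hZ : Z P m 0 z - expFun l z = ∑ q ∈ Finset.range (P + 1),
        ((bumpWeight (q / P) / G P : ℝ) : ℂ) *
          (expFun (ψ (ω m ((q / P : ℝ) : ℂ))) z - expFun l z) := by
      simp only [mul_sub, Finset.sum_sub_distrib]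
      rw [← Finset.sum_mul, ← Complex.ofReal_sum, hone]
      simp [Z]
    rw [hZ]
    refine (norm_sum_le _ _).trans ?_
    calc _ ≤ ∑ q ∈ Finset.range (P + 1), (bumpWeight (q / P) / G P) * ε := by
          refine Finset.sum_le_sum fun q hq => ?_
          have hw : 0 ≤ bumpWeight (q / P) / G P := by
            refine div_nonneg ?_ (hGpos Q).le
            simp only [bumpWeight]
            positivity
          rw [norm_mul, Complex.norm_real, Real.norm_eq_abs, abs_of_nonneg hw]
          exact mul_le_mul_of_nonneg_left
            ((hball _ (hω₁ m hm _ (hunit _ q hq))).1 z hz) hw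
      _ = ε := by rw [← Finset.sum_mul, hone, one_mul]

/-- For a non-scalar operator that commutes with differentiation, the vectors with decaying orbits
are dense. -/
theorem dense_hasDecayingOrbits {T : EntireSpace →L[ℂ] EntireSpace}
    (hT : T ∘L differentiationOp = differentiationOp ∘L T)
    (hc : ∀ c : ℂ, T ≠ c • ContinuousLinearMap.id ℂ EntireSpace) (s₀ : ℝ) :
    Dense {y | HasDecayingOrbits T s₀ y} := by
  obtain ⟨a, ha⟩ := exists_accPt_norm_eq (differentiable_symbol T) (symbol_not_const hT hc)
    (Real.exp_pos (-s₀))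
  refine (dense_span_expFun ha).mono fun y hy => ?_
  induction hy using Submodule.span_induction with
  | mem y hy =>
    obtain ⟨l, ⟨hl, hd⟩, rfl⟩ := hy
    exact hasDecayingOrbits_expFun hT hl hd
  | zero => exact hasDecayingOrbits_zero T s₀
  | add x y _ _ hx hy => exact hx.add hy
  | smul c y _ hy => exact hy.smul c

/-- For a non-scalar operator that commutes with differentiation, the vectors with geometrically
small orbits are dense. -/
theorem dense_setOf_small_orbit {T : EntireSpace →L[ℂ] EntireSpace}
    (hT : T ∘L differentiationOp = differentiationOp ∘L T)
    (hc : ∀ c : ℂ, T ≠ c • ContinuousLinearMap.id ℂ EntireSpace) {r : ℝ} (hr : 0 < r) :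
    Dense {x : EntireSpace | ∀ R > 0, ∀ ε > 0, ∃ A, ∀ n ≥ A, ∀ z, ‖z‖ ≤ R →
      r ^ n * ‖(T ^ n) x z‖ ≤ ε} := by
  have hopen : IsOpen {l | ‖symbol T l‖ < r⁻¹} :=
    isOpen_lt (differentiable_symbol T).continuous.norm continuous_const
  obtain ⟨a, ha⟩ := exists_norm_lt_of_entire (differentiable_symbol T) (symbol_not_const hT hc)
    (inv_pos.2 hr)
  refine (dense_span_expFun (hopen.preperfect a ha)).mono fun y hy => ?_
  induction hy using Submodule.span_induction with
  | mem y hy =>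
    obtain ⟨l, hl, rfl⟩ := hy
    intro R hR ε hε
    obtain ⟨C, hC, hCl⟩ := (expFun l).exists_norm_le R
    have hq : r * ‖symbol T l‖ < 1 := by
      calc r * ‖symbol T l‖ < r * r⁻¹ := by gcongr; exact hl
        _ = 1 := mul_inv_cancel₀ hr.ne'
    have hlim := tendsto_pow_atTop_nhds_zero_of_lt_one (by positivity) hq
    obtain ⟨A, hA⟩ := eventually_atTop.1
      (hlim.eventually_lt_const (show (0 : ℝ) < ε / C by positivity))
    refine ⟨A, fun n hn z hz => ?_⟩
    rw [pow_apply_expFun hT, smul_apply, norm_mul, norm_pow, ← mul_assoc, ← mul_pow]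
    calc _ ≤ ε / C * C := by
          gcongr
          exacts [(hA n hn).le, hCl z hz]
      _ = ε := by field_simp
  | zero =>
    intro R _ ε hε
    exact ⟨0, fun n _ z _ => by simpa using hε.le⟩
  | add x y _ _ hx hy =>
    intro R hR ε hε
    obtain ⟨A₁, h1⟩ := hx R hR (ε / 2) (half_pos hε)
    obtain ⟨A₂, h2⟩ := hy R hR (ε / 2) (half_pos hε)
    refine ⟨max A₁ A₂, fun n hn z hz => ?_⟩
    have h1 := h1 n ((le_max_left _ _).trans hn) z hz
    have h2 := h2 n ((le_max_right _ _).trans hn) z hz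
    rw [map_add, add_apply]
    have := mul_le_mul_of_nonneg_left (norm_add_le ((T ^ n) x z) ((T ^ n) y z)) (pow_pos hr n).le
    linarith
  | smul c y _ hy =>
    intro R hR ε hε
    obtain ⟨A, h⟩ := hy R hR (ε / (‖c‖ + 1)) (by positivity)
    refine ⟨A, fun n hn z hz => ?_⟩
    rw [map_smul, smul_apply, norm_mul]
    calc r ^ n * (‖c‖ * ‖(T ^ n) y z‖) = ‖c‖ * (r ^ n * ‖(T ^ n) y z‖) := by ring
      _ ≤ (‖c‖ + 1) * (ε / (‖c‖ + 1)) :=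
          mul_le_mul (by linarith) (h n hn z hz) (by positivity) (by positivity)
      _ = ε := by field_simp

end EntireSpace

/-! ### The perturbation argument. -/

namespace EntireSpace

open Filter

theorem pow_apply_orbit {T : EntireSpace →L[ℂ] EntireSpace} {y : ℤ → EntireSpace}
    (h : ∀ i, T (y i) = y (i + 1)) (n : ℕ) (i : ℤ) : (T ^ n) (y i) = y (i + n) := by
  induction n with
  | zero => simp
  | succ n ih =>
    rw [pow_succ', mul_apply_eq_comp, ih, h]
    push_cast
    ring_nf

theorem exists_nat_sum_one_div_sq_le {ε : ℝ} (hε : 0 < ε) :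
    ∃ A : ℕ, ∀ K : Finset ℕ, (∀ k ∈ K, A ≤ k) → ∑ k ∈ K, 1 / (k : ℝ) ^ 2 ≤ ε := by
  obtain ⟨s, hs⟩ := summable_iff_vanishing_norm.1
    (Real.summable_one_div_nat_pow.2 one_lt_two) ε hε
  refine ⟨s.sup id + 1, fun K hK => (le_abs_self _).trans (hs K ?_).le⟩
  refine Finset.disjoint_left.2 fun k hk hks => ?_
  have h1 := hK k hk
  have h2 : k ≤ s.sup id := Finset.le_sup (f := id) hks
  omega

/-- The integers `j - k` are distinct, so the bound depends on neither `K` nor `j`; the term `n = 0`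
counts as `1 / 0 = 0`. -/
theorem sum_erase_one_div_sq_le (K : Finset ℕ) (j : ℕ) :
    ∑ k ∈ K.erase j, 1 / ((j : ℝ) - k) ^ 2 ≤ ∑' n : ℤ, 1 / (n : ℝ) ^ 2 := by
  have hinj : Set.InjOn (fun k : ℕ => (j : ℤ) - k) (K.erase j) := fun a _ b _ h => by
    have : (j : ℤ) - a = j - b := h
    omega
  have h := (Real.summable_one_div_int_pow.2 one_lt_two).sum_le_tsum
    ((K.erase j).image fun k : ℕ => (j : ℤ) - k) (fun n _ => by positivity)
  rw [Finset.sum_image hinj] at h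
  refine le_of_eq_of_le (Finset.sum_congr rfl fun k _ => ?_) h
  push_cast
  rfl

theorem norm_exp_mul_sub_one_le {t η : ℝ} (ht : |t| ≤ η) (hη : η ≤ 1) {ξ : ℂ} (hξ : ‖ξ‖ = 1)
    (h : ‖ξ - 1‖ ≤ η) : ‖(Real.exp t : ℂ) * ξ - 1‖ ≤ 3 * η := by
  have h1 : |Real.exp t - 1| ≤ 2 * |t| := Real.abs_exp_sub_one_le (ht.trans hη)
  have e : (Real.exp t : ℂ) * ξ - 1 = ((Real.exp t - 1 : ℝ) : ℂ) * ξ + (ξ - 1) := by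
    push_cast; ring
  rw [e]
  refine (norm_add_le _ _).trans ?_
  rw [norm_mul, hξ, mul_one, Complex.norm_real, Real.norm_eq_abs]
  linarith

/-- Density of the set of entire functions whose orbits under all multiples of `T` with
modulus close to a given one meet a given open set. -/
theorem exists_dense_forall_exists_mem {T : EntireSpace →L[ℂ] EntireSpace}
    (hT : T ∘L differentiationOp = differentiationOp ∘L T)
    (hc : ∀ c : ℂ, T ≠ c • ContinuousLinearMap.id ℂ EntireSpace) {U : Set EntireSpace}
    (hU : IsOpen U) (hUne : U.Nonempty) (s₀ : ℝ) :
    ∃ δ > 0, Dense {f : EntireSpace | ∀ z : ℂ, z ≠ 0 → |Real.log ‖z‖ - s₀| ≤ δ →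
      ∃ n : ℕ, z ^ n • (T ^ n) f ∈ U} := by
  obtain ⟨y, hyU, hy⟩ := (dense_hasDecayingOrbits hT hc s₀).inter_open_nonempty U hU hUne
  obtain ⟨R, hR, ε, hε, hball⟩ := exists_radius_of_mem_nhds (hU.mem_nhds hyU)
  obtain ⟨δ₀, hδ₀, Y, hY1, hY2, hY3⟩ := hy R hR (ε / 4) (by positivity)
  obtain ⟨C, hC, hCY⟩ := hY2 R hR
  set η := min 1 (ε / (12 * C)) with hη
  have hηpos : 0 < η := by positivity
  have hη1 : η ≤ 1 := min_le_left _ _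
  have hηC : 3 * η * C ≤ ε / 4 := by
    calc 3 * η * C ≤ 3 * (ε / (12 * C)) * C := by gcongr; exact min_le_right _ _
      _ = ε / 4 := by field_simp; norm_num
  obtain ⟨L, hL, c, hc1, hcph⟩ := exists_phases hηpos
  set S₀ := ∑' n : ℤ, 1 / (n : ℝ) ^ 2 with hS₀
  have hS₀nn : 0 ≤ S₀ := tsum_nonneg fun n => by positivity
  -- Spacing the times by `N` divides the total interference by `N²`.
  obtain ⟨N, hN⟩ := exists_nat_gt (16 * C * S₀ / ε)
  have hNpos : 0 < N := by
    have : (0 : ℝ) < N := lt_of_le_of_lt (by positivity) hN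
    exact_mod_cast this
  have hNR : (0 : ℝ) < N := by exact_mod_cast hNpos
  have hN1 : (1 : ℝ) ≤ N := by exact_mod_cast hNpos
  have hNS : 4 * C * S₀ / N ^ 2 ≤ ε / 4 := by
    rw [div_lt_iff₀ hε] at hN
    rw [div_le_iff₀ (by positivity)]
    have : (N : ℝ) ≤ N ^ 2 := by nlinarith
    nlinarith
  obtain ⟨δ, hδ, hrad⟩ := exists_radii s₀ hδ₀ hNpos hL hηpos
  refine ⟨δ, hδ, dense_iff_inter_open.2 fun V hV hVne => ?_⟩
  obtain ⟨x, hxV, hx⟩ := (dense_setOf_small_orbit hT hc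
    (Real.exp_pos (s₀ + δ))).inter_open_nonempty V hV hVne
  obtain ⟨R', hR', ε', hε', hball'⟩ := exists_radius_of_mem_nhds (hV.mem_nhds hxV)
  obtain ⟨C', hC', hCY'⟩ := hY2 R' hR'
  obtain ⟨A₁, hA₁⟩ := hx R hR (ε / 4) (by positivity)
  obtain ⟨A₂, hA₂⟩ := exists_nat_sum_one_div_sq_le (ε := ε' / C') (by positivity)
  obtain ⟨K, ρ, m, hKA, hKm, hKρ, hKs⟩ := hrad (max 1 (max A₁ A₂))
  -- All times `N(j - k)` with `j, k ∈ K` then lie in `[-Q, Q]`, where the decay bound is valid.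
  set Q := N * K.sup id with hQ
  have hKQ : ∀ k ∈ K, N * k ≤ Q := fun k hk =>
    Nat.mul_le_mul_left N (Finset.le_sup (f := id) hk)
  have hK1 : ∀ k ∈ K, (1 : ℝ) ≤ k := fun k hk => by
    exact_mod_cast (le_max_left _ _).trans (hKA k hk)
  let b : ℕ → ℂ := fun k => c (k % L) * (Real.exp (-(N * k * ρ k)) : ℝ)
  have hb : ∀ k, ‖b k‖ = Real.exp (-(N * k * ρ k)) := fun k => by
    simp only [b]
    rw [norm_mul, hc1, one_mul, Complex.norm_real, Real.norm_eq_abs, Real.abs_exp]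
  set f := x + ∑ k ∈ K, b k • Y Q (m k) (-(N * k : ℕ)) with hf
  refine ⟨f, hball' f fun w hw => ?_, fun z hz hzs => ?_⟩
  · rw [hf, add_apply, add_sub_cancel_left, sum_apply]
    refine (norm_sum_le _ _).trans ?_
    calc _ ≤ ∑ k ∈ K, C' * (1 / (k : ℝ) ^ 2) := by
          refine Finset.sum_le_sum fun k hk => ?_
          have hk1 := hK1 k hk
          have h1 := hCY' Q (m k) (-(N * k : ℕ)) (hKm k hk)
            (by rw [abs_neg, Nat.abs_cast]; exact_mod_cast hKQ k hk) w hw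
          rw [smul_apply, norm_mul, hb]
          calc _ ≤ Real.exp (-(N * k * ρ k)) *
                (C' * Real.exp (((-(N * k : ℕ) : ℤ) : ℝ) * m k) /
                  (1 + ((-(N * k : ℕ) : ℤ) : ℝ) ^ 2)) := by gcongr
            -- The perturbation at time `0` is the case `j = 0` of the concavity inequality, so each
            -- summand is at most `C' / k²`.
            _ = C' * (Real.exp (N * ((0 : ℕ) * ρ 0 - k * ρ k + ((0 : ℕ) - k) * m k)) /
                  (1 + (N * k : ℝ) ^ 2)) := by
                have e : Real.exp (N * ((0 : ℕ) * ρ 0 - k * ρ k + ((0 : ℕ) - k) * m k)) =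
                    Real.exp (-(N * k * ρ k)) * Real.exp (((-(N * k : ℕ) : ℤ) : ℝ) * m k) := by
                  rw [← Real.exp_add]
                  congr 1
                  push_cast
                  ring
                rw [e]
                push_cast
                ring
            _ ≤ C' * (1 / (k : ℝ) ^ 2) := by
                gcongr
                · exact Real.exp_le_one_iff.2
                    (mul_nonpos_of_nonneg_of_nonpos hNR.le (hKρ k hk 0))
                · have : (k : ℝ) ≤ N * k := le_mul_of_one_le_left (by positivity) hN1
                  have : (k : ℝ) ^ 2 ≤ (N * k) ^ 2 := by gcongr
                  linarith
      _ = C' * ∑ k ∈ K, 1 / (k : ℝ) ^ 2 := by rw [Finset.mul_sum]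
      _ ≤ C' * (ε' / C') := by
          gcongr
          exact hA₂ K fun k hk => ((le_max_right _ _).trans (le_max_right _ _)).trans (hKA k hk)
      _ = ε' := by field_simp
  · set s := Real.log ‖z‖ with hs
    have hzpos : 0 < ‖z‖ := norm_pos_iff.2 hz
    have hexp : Real.exp s = ‖z‖ := Real.exp_log hzpos
    obtain ⟨i, hi⟩ := hKs s hzs
    set ξ := z / (‖z‖ : ℂ) with hξ
    have hξ1 : ‖ξ‖ = 1 := by
      rw [hξ, norm_div, Complex.norm_real, norm_norm, div_self hzpos.ne']
    have hzξ : z = (Real.exp s : ℝ) * ξ := by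
      rw [hexp, hξ, mul_div_cancel₀]
      exact_mod_cast hzpos.ne'
    obtain ⟨l, hl, hphase⟩ := hcph (ξ ^ (N * (i * L))) (ξ ^ N) (by simp [hξ1]) (by simp [hξ1])
    obtain ⟨hjK, hjs⟩ := hi l hl
    set j := i * L + l with hj
    have hjl : j % L = l := by
      rw [hj, mul_comm, Nat.mul_add_mod, Nat.mod_eq_of_lt hl]
    rw [← pow_mul, ← pow_add, ← mul_add, ← hj] at hphase
    refine ⟨N * j, hball _ fun w hw => ?_⟩
    have hznorm : ‖z ^ (N * j)‖ = Real.exp (N * j * s) := by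
      rw [norm_pow, ← hexp, ← Real.exp_nat_mul]
      push_cast
      rfl
    have hTf : (T ^ (N * j)) f = (T ^ (N * j)) x +
        ∑ k ∈ K, b k • Y Q (m k) ((N : ℤ) * (j - k)) := by
      rw [hf, map_add, map_sum]
      congr 1
      refine Finset.sum_congr rfl fun k hk => ?_
      rw [map_smul, pow_apply_orbit (fun i => hY1 Q (m k) i (hKm k hk))]
      congr 2
      push_cast
      ring
    have hx1 : ‖z ^ (N * j) * (T ^ (N * j)) x w‖ ≤ ε / 4 := by
      rw [norm_mul, norm_pow]
      refine le_trans ?_ (hA₁ (N * j) ?_ w hw)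
      · gcongr
        rw [← hexp]
        exact Real.exp_le_exp.2 (by linarith [(abs_le.1 hzs).2])
      · exact (((le_max_left _ _).trans (le_max_right _ _)).trans (hKA j hjK)).trans
          (Nat.le_mul_of_pos_left _ hNpos)
    have hx2 : ‖(z ^ (N * j) * b j - 1) * Y Q (m j) 0 w‖ ≤ ε / 4 := by
      have e : z ^ (N * j) * b j = (Real.exp (N * j * (s - ρ j)) : ℝ) * (ξ ^ (N * j) * c l) := by
        have e1 : Real.exp (N * j * (s - ρ j)) = Real.exp s ^ (N * j) *
            Real.exp (-(N * j * ρ j)) := by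
          rw [← Real.exp_nat_mul, ← Real.exp_add]
          congr 1
          push_cast
          ring
        simp only [b]
        rw [hjl, hzξ, e1, mul_pow]
        push_cast
        ring
      have h1 := norm_exp_mul_sub_one_le hjs hη1 (by simp [hξ1, hc1]) hphase
      have h2 := hCY Q (m j) 0 (hKm j hjK) (by simp) w hw
      simp only [Int.cast_zero, zero_mul, Real.exp_zero, mul_one, ne_eq, OfNat.ofNat_ne_zero,
        not_false_eq_true, zero_pow, add_zero, div_one] at h2
      rw [norm_mul, e]
      exact (mul_le_mul h1 h2 (norm_nonneg _) (by positivity)).trans hηC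
    have hx3 := hY3 Q (m j) (hKm j hjK) w hw
    have hx4 : ‖∑ k ∈ K.erase j, z ^ (N * j) * (b k * Y Q (m k) ((N : ℤ) * (j - k)) w)‖ ≤
        ε / 4 := by
      refine (norm_sum_le _ _).trans ?_
      calc _ ≤ ∑ k ∈ K.erase j, 4 * C / N ^ 2 * (1 / ((j : ℝ) - k) ^ 2) := by
            refine Finset.sum_le_sum fun k hk => ?_
            obtain ⟨hkj, hkK⟩ := Finset.mem_erase.1 hk
            have hjk : (0 : ℝ) < ((j : ℝ) - k) ^ 2 := by
              have : (j : ℝ) - k ≠ 0 := sub_ne_zero.2 (by exact_mod_cast hkj.symm)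
              positivity
            have hbound : |(N : ℤ) * (j - k)| ≤ Q := by
              have h1 := hKQ j hjK
              have h2 := hKQ k hkK
              zify at h1 h2
              have h3 : (0 : ℤ) ≤ N * j := by positivity
              have h4 : (0 : ℤ) ≤ N * k := by positivity
              rw [mul_sub, abs_le]
              constructor <;> linarith
            have h1 := hCY Q (m k) ((N : ℤ) * (j - k)) (hKm k hkK) hbound w hw
            rw [norm_mul, norm_mul, hb, hznorm]
            have e : Real.exp (N * j * s) * (Real.exp (-(N * k * ρ k)) *
                Real.exp ((((N : ℤ) * (j - k) : ℤ) : ℝ) * m k)) =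
                Real.exp (N * j * (s - ρ j)) *
                  Real.exp (N * (j * ρ j - k * ρ k + (j - k) * m k)) := by
              rw [← Real.exp_add, ← Real.exp_add, ← Real.exp_add]
              congr 1
              push_cast
              ring
            have h2 : Real.exp (N * j * (s - ρ j)) ≤ 4 := by
              have h3 : N * j * (s - ρ j) ≤ 1 := (le_abs_self _).trans (hjs.trans hη1)
              have h4 := Real.exp_le_exp.2 h3
              have := Real.exp_one_lt_d9
              linarith
            have h3 : Real.exp (N * (j * ρ j - k * ρ k + (j - k) * m k)) ≤ 1 :=
              Real.exp_le_one_iff.2 (mul_nonpos_of_nonneg_of_nonpos hNR.le (hKρ k hkK j))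
            calc _ ≤ Real.exp (N * j * s) * (Real.exp (-(N * k * ρ k)) *
                  (C * Real.exp ((((N : ℤ) * (j - k) : ℤ) : ℝ) * m k) /
                    (1 + (((N : ℤ) * (j - k) : ℤ) : ℝ) ^ 2))) := by gcongr
              _ = (Real.exp (N * j * s) * (Real.exp (-(N * k * ρ k)) *
                  Real.exp ((((N : ℤ) * (j - k) : ℤ) : ℝ) * m k))) * C /
                    (1 + (N * (j - k) : ℝ) ^ 2) := by
                  push_cast
                  ring
              _ ≤ 4 * 1 * C / (N * (j - k) : ℝ) ^ 2 := by
                  rw [e]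
                  have : (N * (j - k) : ℝ) ^ 2 ≤ 1 + (N * (j - k) : ℝ) ^ 2 := by linarith
                  have : 0 < (N * (j - k) : ℝ) ^ 2 := by rw [mul_pow]; positivity
                  gcongr
              _ = _ := by rw [mul_pow]; field_simp
        _ = 4 * C / N ^ 2 * ∑ k ∈ K.erase j, 1 / ((j : ℝ) - k) ^ 2 := by rw [Finset.mul_sum]
        _ ≤ 4 * C / N ^ 2 * S₀ := by
            gcongr
            exact sum_erase_one_div_sq_le K j
        _ = 4 * C * S₀ / N ^ 2 := by ring
        _ ≤ ε / 4 := hNS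
    -- Four errors: the orbit of `x`, the mismatch of `z^{Nj} b_j` with `1`, the distance from `Y`
    -- to `y`, and the interference of the indices `k ≠ j`.
    have hsplit : (z ^ (N * j) • (T ^ (N * j)) f) w - y w =
        z ^ (N * j) * (T ^ (N * j)) x w + (z ^ (N * j) * b j - 1) * Y Q (m j) 0 w +
        (Y Q (m j) 0 w - y w) +
        ∑ k ∈ K.erase j, z ^ (N * j) * (b k * Y Q (m k) ((N : ℤ) * (j - k)) w) := by
      rw [hTf, smul_apply, add_apply, sum_apply, ← Finset.add_sum_erase K _ hjK, ← Finset.mul_sum]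
      simp only [smul_apply, sub_self, mul_zero]
      ring
    rw [hsplit]
    calc _ ≤ ε / 4 + ε / 4 + ε / 4 + ε / 4 :=
          norm_add_le_of_le (norm_add_le_of_le (norm_add_le_of_le hx1 hx2) hx3) hx4
      _ = ε := by ring

/-! ### The Baire category argument. -/

theorem isOpen_forall_exists_mem (T : EntireSpace →L[ℂ] EntireSpace) {U : Set EntireSpace}
    (hU : IsOpen U) {K : Set ℂ} (hK : IsCompact K) :
    IsOpen {f : EntireSpace | ∀ z ∈ K, ∃ n : ℕ, z ^ n • (T ^ n) f ∈ U} := by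
  refine isOpen_iff_mem_nhds.2 fun f hf =>
    hK.eventually_forall_of_forall_eventually fun z hz => ?_
  obtain ⟨n, hn⟩ := hf z hz
  have hcont : Continuous fun p : EntireSpace × ℂ => p.2 ^ n • (T ^ n) p.1 :=
    (continuous_snd.pow n).smul ((T ^ n).continuous.comp continuous_fst)
  filter_upwards [hcont.continuousAt.preimage_mem_nhds (hU.mem_nhds hn)] with p hp using ⟨n, hp⟩

theorem isCompact_log_annulus (s₀ δ : ℝ) :
    IsCompact {z : ℂ | z ≠ 0 ∧ |Real.log ‖z‖ - s₀| ≤ δ} := by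
  have : {z : ℂ | z ≠ 0 ∧ |Real.log ‖z‖ - s₀| ≤ δ} =
      Metric.closedBall 0 (Real.exp (s₀ + δ)) ∩ {z | Real.exp (s₀ - δ) ≤ ‖z‖} := by
    ext z
    rw [Set.mem_inter_iff, mem_closedBall_zero_iff]
    simp only [Set.mem_ofPred_eq, abs_le]
    constructor
    · rintro ⟨hz, h1, h2⟩
      have hpos := norm_pos_iff.2 hz
      exact ⟨(Real.log_le_iff_le_exp hpos).1 (by linarith),
        (Real.le_log_iff_exp_le hpos).1 (by linarith)⟩
    · rintro ⟨h1, h2⟩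
      have hpos : 0 < ‖z‖ := (Real.exp_pos _).trans_le h2
      have h3 := (Real.log_le_iff_le_exp hpos).2 h1
      have h4 := (Real.le_log_iff_exp_le hpos).2 h2
      exact ⟨norm_pos_iff.1 hpos, by linarith, by linarith⟩
  rw [this]
  exact (isCompact_closedBall _ _).inter_right (isClosed_le continuous_const continuous_norm)

theorem isGδ_and_dense_forall_exists_mem {T : EntireSpace →L[ℂ] EntireSpace}
    (hT : T ∘L differentiationOp = differentiationOp ∘L T)
    (hc : ∀ c : ℂ, T ≠ c • ContinuousLinearMap.id ℂ EntireSpace) {U : Set EntireSpace}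
    (hU : IsOpen U) (hUne : U.Nonempty) :
    IsGδ {f : EntireSpace | ∀ z : ℂ, z ≠ 0 → ∃ n : ℕ, z ^ n • (T ^ n) f ∈ U} ∧
    Dense {f : EntireSpace | ∀ z : ℂ, z ≠ 0 → ∃ n : ℕ, z ^ n • (T ^ n) f ∈ U} := by
  choose δ hδ hdense using exists_dense_forall_exists_mem hT hc hU hUne
  -- The width `δ` depends on `s₀` and `U`; by Lindelöf, countably many intervals cover all values
  -- of `log |z|`.
  obtain ⟨S, hS, hcover⟩ := TopologicalSpace.countable_cover_nhds
    (fun s : ℝ => Metric.closedBall_mem_nhds s (hδ s))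
  set G : ℝ → Set EntireSpace := fun s₀ => {f | ∀ z ∈ {z : ℂ | z ≠ 0 ∧
    |Real.log ‖z‖ - s₀| ≤ δ s₀}, ∃ n : ℕ, z ^ n • (T ^ n) f ∈ U} with hG
  have hGo : ∀ s, IsOpen (G s) := fun s =>
    isOpen_forall_exists_mem T hU (isCompact_log_annulus s (δ s))
  have hGd : ∀ s, Dense (G s) := fun s => (hdense s).mono (by
    intro f hf z hz
    exact hf z hz.1 hz.2)
  have heq : {f : EntireSpace | ∀ z : ℂ, z ≠ 0 → ∃ n : ℕ, z ^ n • (T ^ n) f ∈ U} =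
      ⋂ s ∈ S, G s := by
    ext f
    simp only [Set.mem_iInter]
    refine ⟨fun hf s _ z hz => hf z hz.1, fun hf z hz => ?_⟩
    have hmem : Real.log ‖z‖ ∈ ⋃ s ∈ S, Metric.closedBall s (δ s) := hcover ▸ Set.mem_univ _
    simp only [Set.mem_iUnion, exists_prop] at hmem
    obtain ⟨s, hs, hzs⟩ := hmem
    exact hf s hs z ⟨hz, by simpa [Real.dist_eq] using hzs⟩
  rw [heq]
  exact ⟨IsGδ.biInter hS fun s _ => (hGo s).isGδ,
    dense_biInter_of_isOpen (fun s _ => hGo s) hS fun s _ => hGd s⟩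

theorem isGδ_and_dense_commonHypercyclicVectors {T : EntireSpace →L[ℂ] EntireSpace}
    (hT : T ∘L differentiationOp = differentiationOp ∘L T)
    (hc : ∀ c : ℂ, T ≠ c • ContinuousLinearMap.id ℂ EntireSpace) :
    IsGδ (commonHypercyclicVectors fun z : {z : ℂ // z ≠ 0} => (z : ℂ) • T) ∧
    Dense (commonHypercyclicVectors fun z : {z : ℂ // z ≠ 0} => (z : ℂ) • T) := by
  set B := TopologicalSpace.countableBasis EntireSpace with hB
  have hBb := TopologicalSpace.isBasis_countableBasis EntireSpace
  have heq : (commonHypercyclicVectors fun z : {z : ℂ // z ≠ 0} => (z : ℂ) • T) =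
      ⋂ U ∈ B, {f : EntireSpace | ∀ z : ℂ, z ≠ 0 → ∃ n : ℕ, z ^ n • (T ^ n) f ∈ U} := by
    ext f
    simp only [commonHypercyclicVectors, hypercyclicVectors, universalElements, Set.mem_iInter,
      Set.mem_ofPred_eq, hBb.dense_iff, Subtype.forall, smul_pow]
    constructor
    · intro h U hU z hz
      obtain ⟨_, hgU, n, rfl⟩ := h z hz U hU (TopologicalSpace.nonempty_of_mem_countableBasis hU)
      exact ⟨n, hgU⟩
    · intro h z hz U hU _
      obtain ⟨n, hn⟩ := h U hU z hz
      exact ⟨_, hn, n, rfl⟩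
  rw [heq]
  have hBc : B.Countable := TopologicalSpace.countable_countableBasis EntireSpace
  have hU : ∀ U ∈ B, _ ∧ _ := fun U hU => isGδ_and_dense_forall_exists_mem hT hc
    (hBb.isOpen hU) (TopologicalSpace.nonempty_of_mem_countableBasis hU)
  exact ⟨IsGδ.biInter hBc fun U h => (hU U h).1,
    dense_biInter_of_Gδ (fun U h => (hU U h).1) hBc fun U h => (hU U h).2⟩

/-! ### Polynomials in the differentiation operator. -/

theorem aeval_comp_differentiationOp (p : Polynomial ℂ) :
    Polynomial.aeval differentiationOp p ∘L differentiationOp =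
      differentiationOp ∘L Polynomial.aeval differentiationOp p := by
  have h := congrArg (Polynomial.aeval differentiationOp) (mul_comm p Polynomial.X)
  rwa [map_mul, map_mul, Polynomial.aeval_X] at h

theorem aeval_differentiationOp_expFun (p : Polynomial ℂ) (l : ℂ) :
    Polynomial.aeval differentiationOp p (expFun l) = p.eval l • expFun l := by
  induction p using Polynomial.induction_on' with
  | add p q hp hq => rw [map_add, _root_.add_apply, hp, hq, Polynomial.eval_add, add_smul]
  | monomial n a =>
    have h : ∀ n : ℕ, (differentiationOp ^ n) (expFun l) = l ^ n • expFun l := by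
      intro n
      induction n with
      | zero => simp
      | succ n ih =>
        rw [pow_succ', mul_apply_eq_comp, ih, map_smul, differentiationOp_expFun, smul_smul,
          pow_succ]
    rw [Polynomial.aeval_monomial, ← Algebra.smul_def, _root_.smul_apply, h, smul_smul,
      Polynomial.eval_monomial]

/-- The eigenvalue of `p(D)` on `e^{lz}` is `p(l)`, so a scalar `p(D)` would make `p` constant. -/
theorem aeval_differentiationOp_ne_smul_id {p : Polynomial ℂ}
    (hp : ∀ c : ℂ, p ≠ Polynomial.C c) (c : ℂ) :
    Polynomial.aeval differentiationOp p ≠ c • ContinuousLinearMap.id ℂ EntireSpace := by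
  intro h
  refine hp c (Polynomial.funext fun l => ?_)
  have h1 := congrArg (fun g : EntireSpace => g 0)
    ((aeval_differentiationOp_expFun p l).symm.trans (DFunLike.congr_fun h (expFun l)))
  simpa using h1

end EntireSpace

theorem mainTheorem8 :
    -- every non-scalar operator that commutes with differentiation
    (∀ T : EntireSpace →L[ℂ] EntireSpace,
      T ∘L differentiationOp = differentiationOp ∘L T →
      (∀ c : ℂ, T ≠ c • ContinuousLinearMap.id ℂ EntireSpace) →
      IsGδ (commonHypercyclicVectors fun z : {z : ℂ // z ≠ 0} => (z : ℂ) • T) ∧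
      Dense (commonHypercyclicVectors fun z : {z : ℂ // z ≠ 0} => (z : ℂ) • T)) ∧
    -- the special case of a non-constant polynomial in the differentiation operator
    (∀ p : Polynomial ℂ, (∀ c : ℂ, p ≠ Polynomial.C c) →
      (Polynomial.aeval differentiationOp p ∘L differentiationOp =
        differentiationOp ∘L Polynomial.aeval differentiationOp p ∧
      (∀ c : ℂ, Polynomial.aeval differentiationOp p ≠
        c • ContinuousLinearMap.id ℂ EntireSpace)) ∧
      IsGδ (commonHypercyclicVectors fun z : {z : ℂ // z ≠ 0} =>
        (z : ℂ) • Polynomial.aeval differentiationOp p) ∧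
      Dense (commonHypercyclicVectors fun z : {z : ℂ // z ≠ 0} =>
        (z : ℂ) • Polynomial.aeval differentiationOp p)) := by
  refine ⟨fun T hT hc => EntireSpace.isGδ_and_dense_commonHypercyclicVectors hT hc, fun p hp => ?_⟩
  have hcomm := EntireSpace.aeval_comp_differentiationOp p
  have hne := EntireSpace.aeval_differentiationOp_ne_smul_id hp
  exact ⟨⟨hcomm, hne⟩, EntireSpace.isGδ_and_dense_commonHypercyclicVectors hcomm hne⟩
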